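/- Let $n\ge 1$ and let $(C,0)\subset(\mathbb{C}^2,0)$ be the plane curve singularity of type $A_{2n-1}$ given by $y^2=x^{2n}$. Let $\gamma_1,\gamma_2:(\mathbb{C},0)\to(\mathbb{C}^2,0)$ be uniformizations of its two irreducible components, and for $f\in\mathcal{O}=\mathcal{O}_{\mathbb{C}^2,0}$ put $v_i(f)=\operatorname{Ord}_0 f(\gamma_i(t))$. Then the motivic Poincaré series of $C$ is $$P_g(t_1,t_2)=1+qt_1t_2+\dots+q^{n-1}(t_1t_2)^{n-1}+\frac{q^n(1-q)(t_1t_2)^n}{(1-qt_1)(1-qt_2)},$$ for both of the following descriptions of $P_g$. (1) As a motivic integral: $P_g(t_1,t_2)=\int_{\mathbb{P}\mathcal{O}}t_1^{v_1}t_2^{v_2}\,d\mu=\sum_{v\in\mathbb{Z}_{\ge0}^2}\mu\big(\{v_1(f)=v_1,\ v_2(f)=v_2\}\big)\,t_1^{v_1}t_2^{v_2}$, with $q=\mathbb{L}^{-1}\in K_0(\mathrm{Var}_{\mathbb{C}})[\mathbb{L}^{-1}]$, where $\mathbb{L}$ is the class of the affine line and a cylinder $A=\pi_k^{-1}(A_k)\subset\mathbb{P}\mathcal{O}$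 over a constructible set $A_k$ in the projectivization $\mathbb{P}j_k(\mathcal{O})$ of the space of $k$-jets has the measure $\mu(A)=[A_k]\,\mathbb{L}^{-\dim\mathbb{P}j_k(\mathcal{O})}$, $\dim\mathbb{P}j_k(\mathcal{O})=\frac{(k+1)(k+2)}2-1$. (2) Through the multi-index filtration, with a formal variable $q$: for $v\in\mathbb{Z}^2$ the subspace $J_v=\{f\in\mathcal{O}: v_1(f)\ge v_1,\ v_2(f)\ge v_2\}$ has finite codimension $h(v)$ in $\mathcal{O}$, and $$P_g(t_1,t_2)=\frac{L_g(t_1,t_2)\,(t_1-1)(t_2-1)}{t_1t_2-1},\qquad L_g(t_1,t_2)=\sum_{v\in\mathbb{Z}^2}\frac{q^{h(v)}-q^{h(v+(1,1))}}{1-q}\,t_1^{v_1}t_2^{v_2}.$$ -/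

import Mathlib

open Filter Topology

namespace MotivicPoincare

/-! ### Quasi-projective varieties over `ℂ` -/

/-- Zariski closed subsets of the projective space with homogeneous coordinates indexed by `σ`:
common zero sets of homogeneous polynomials. -/
def IsZariskiClosed {σ : Type} (Z : Set (Projectivization ℂ (σ → ℂ))) : Prop :=
  ∃ S : Set (MvPolynomial σ ℂ), (∀ p ∈ S, ∃ d : ℕ, p.IsHomogeneous d) ∧
    Z = {x | ∀ p ∈ S, MvPolynomial.eval x.rep p = 0}

/-- Locally closed subsets of projective space, that is, quasi-projective varieties. -/
def IsZariskiLocallyClosed {σ : Type} (X : Set (Projectivization ℂ (σ → ℂ))) : Prop :=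
  ∃ A B : Set (Projectivization ℂ (σ → ℂ)), IsZariskiClosed A ∧ IsZariskiClosed B ∧ X = A \ B

/-- Regular maps between subsets of projective spaces: locally in the Zariski topology, given by
homogeneous polynomials of one and the same degree without common zeros. -/
def IsRegularMap {σ τ : Type} {X : Set (Projectivization ℂ (σ → ℂ))}
    {Y : Set (Projectivization ℂ (τ → ℂ))} (φ : X → Y) : Prop :=
  ∀ x : X, ∃ B : Set (Projectivization ℂ (σ → ℂ)), IsZariskiClosed B ∧ (x : Projectivization ℂ (σ → ℂ)) ∉ B ∧
    ∃ (d : ℕ) (F : τ → MvPolynomial σ ℂ), (∀ j, (F j).IsHomogeneous d) ∧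
      ∀ z : X, (z : Projectivization ℂ (σ → ℂ)) ∉ B →
        ∃ h : (fun j => MvPolynomial.eval z.1.rep (F j)) ≠ 0,
          (φ z : Projectivization ℂ (τ → ℂ)) = Projectivization.mk ℂ _ h

/-- Isomorphism of quasi-projective varieties. -/
def AreIsomorphic {σ τ : Type} (X : Set (Projectivization ℂ (σ → ℂ)))
    (Y : Set (Projectivization ℂ (τ → ℂ))) : Prop :=
  ∃ e : X ≃ Y, IsRegularMap e ∧ IsRegularMap e.symm

/-- The product of two quasi-projective varieties, in the Segre embedding. -/
def segreProduct {σ τ : Type} (X : Set (Projectivization ℂ (σ → ℂ)))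
    (Y : Set (Projectivization ℂ (τ → ℂ))) : Set (Projectivization ℂ (σ × τ → ℂ)) :=
  {z | ∃ x ∈ X, ∃ y ∈ Y, ∃ h : (fun ij : σ × τ => x.rep ij.1 * y.rep ij.2) ≠ 0,
    z = Projectivization.mk ℂ _ h}

/-- A complex quasi-projective variety. -/
structure QProjVar where
  /-- the index set of the homogeneous coordinates of the ambient projective space -/
  index : Type
  finite_index : Finite index
  carrier : Set (Projectivization ℂ (index → ℂ))
  locallyClosed : IsZariskiLocallyClosed carrier

/-! ### The Grothendieck ring of varieties -/

/-- The free commutative ring on the quasi-projective varieties. -/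
abbrev FreeVar : Type 1 := MvPolynomial QProjVar ℤ

/-- The generator attached to a locally closed subset of a projective space. -/
noncomputable def gen {σ : Type} [hσ : Finite σ] (X : Set (Projectivization ℂ (σ → ℂ)))
    (hX : IsZariskiLocallyClosed X) : FreeVar :=
  MvPolynomial.X ⟨σ, hσ, X, hX⟩

/-- The defining relations of the Grothendieck ring: isomorphic varieties have the same class,
`[X] = [Y] + [X \ Y]` for `Y = X ∩ Z` closed in `X`, `[X] * [Y] = [X × Y]`, and the class of a
point is `1`. -/
inductive GrothendieckRel : FreeVar → FreeVar → Prop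
  | iso {σ τ : Type} [Finite σ] [Finite τ] (X : Set (Projectivization ℂ (σ → ℂ)))
      (Y : Set (Projectivization ℂ (τ → ℂ))) (hX : IsZariskiLocallyClosed X)
      (hY : IsZariskiLocallyClosed Y) (h : AreIsomorphic X Y) :
      GrothendieckRel (gen X hX) (gen Y hY)
  | scissor {σ : Type} [Finite σ] (X Z : Set (Projectivization ℂ (σ → ℂ)))
      (hX : IsZariskiLocallyClosed X) (hZ : IsZariskiClosed Z)
      (hXZ : IsZariskiLocallyClosed (X ∩ Z)) (hXZ' : IsZariskiLocallyClosed (X \ Z)) :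
      GrothendieckRel (gen X hX) (gen (X ∩ Z) hXZ + gen (X \ Z) hXZ')
  | prod {σ τ : Type} [Finite σ] [Finite τ] (X : Set (Projectivization ℂ (σ → ℂ)))
      (Y : Set (Projectivization ℂ (τ → ℂ))) (hX : IsZariskiLocallyClosed X)
      (hY : IsZariskiLocallyClosed Y) (hXY : IsZariskiLocallyClosed (segreProduct X Y)) :
      GrothendieckRel (gen X hX * gen Y hY) (gen (segreProduct X Y) hXY)
  | point {σ : Type} [Finite σ] (x : Projectivization ℂ (σ → ℂ))
      (hx : IsZariskiLocallyClosed {x}) : GrothendieckRel (gen {x} hx) 1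

/-- The Grothendieck ring `K₀(Var_ℂ)` of complex quasi-projective varieties. -/
abbrev K0 : Type 1 := FreeVar ⧸ Ideal.ofRel GrothendieckRel

/-- The class in `K₀(Var_ℂ)` of a locally closed subset of a projective space. -/
noncomputable def K0.classOf {σ : Type} [Finite σ] (X : Set (Projectivization ℂ (σ → ℂ)))
    (hX : IsZariskiLocallyClosed X) : K0 :=
  Ideal.Quotient.mk _ (gen X hX)

/-- `HasClass Y c`: the set `Y` is constructible, and its class in `K₀(Var_ℂ)`, the sum of the
classes of the pieces of a finite partition into locally closed sets, is `c`. -/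
inductive HasClass {σ : Type} [Finite σ] : Set (Projectivization ℂ (σ → ℂ)) → K0 → Prop
  | locallyClosed (X : Set (Projectivization ℂ (σ → ℂ))) (hX : IsZariskiLocallyClosed X) :
      HasClass X (K0.classOf X hX)
  | disjointUnion (X Y : Set (Projectivization ℂ (σ → ℂ))) (a b : K0) (hX : HasClass X a)
      (hY : HasClass Y b) (hXY : Disjoint X Y) : HasClass (X ∪ Y) (a + b)

/-- The affine line `{[x₀ : x₁] | x₀ ≠ 0}`. -/
def affineLine : Set (Projectivization ℂ (Fin 2 → ℂ)) := {x | x.rep 0 ≠ 0}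

theorem affineLine_locallyClosed : IsZariskiLocallyClosed affineLine := by
  refine ⟨Set.univ, {x | x.rep 0 = 0}, ⟨∅, by simp, by simp⟩,
    ⟨{MvPolynomial.X 0}, ?_, by simp⟩, ?_⟩
  · rintro p rfl
    exact ⟨1, MvPolynomial.isHomogeneous_X ℂ 0⟩
  · ext x
    simp [affineLine]

/-- `𝕃`, the class of the affine line. -/
noncomputable def lefschetz : K0 := K0.classOf affineLine affineLine_locallyClosed

/-- The localisation `K₀(Var_ℂ)[𝕃⁻¹]`. -/
abbrev K0Loc : Type 1 := Localization.Away lefschetz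

/-- `q = 𝕃⁻¹`. -/
noncomputable def qMot : K0Loc := IsLocalization.Away.invSelf lefschetz

/-! ### Germs of functions, jets, orders along arcs -/

/-- The space `𝒪` of germs at the origin of holomorphic functions on `ℂ²`. -/
noncomputable def HolGerm : Submodule ℂ (Germ (𝓝 (0 : ℂ × ℂ)) ℂ) where
  carrier := {g | ∃ f : ℂ × ℂ → ℂ, AnalyticAt ℂ f 0 ∧ g = (f : Germ (𝓝 (0 : ℂ × ℂ)) ℂ)}
  add_mem' := by
    rintro _ _ ⟨f, hf, rfl⟩ ⟨g, hg, rfl⟩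
    exact ⟨f + g, hf.add hg, rfl⟩
  zero_mem' := ⟨0, analyticAt_const, rfl⟩
  smul_mem' := by
    rintro c _ ⟨f, hf, rfl⟩
    exact ⟨c • f, hf.const_smul, rfl⟩

/-- The Taylor coefficient `(∂ᵃ⁺ᵇ f / ∂xᵃ ∂yᵇ)(0) / (a! b!)` of the germ of a function. -/
noncomputable def taylorCoeff (a b : ℕ) (g : Germ (𝓝 (0 : ℂ × ℂ)) ℂ) : ℂ :=
  Quotient.liftOn g
    (fun f => iteratedFDeriv ℂ (a + b) f 0
      (fun i : Fin (a + b) => if (i : ℕ) < a then ((1, 0) : ℂ × ℂ) else (0, 1)) /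
        ((a.factorial : ℂ) * (b.factorial : ℂ)))
    (fun _ _ h => by
      have := (EventuallyEq.iteratedFDeriv ℂ h (a + b)).eq_of_nhds
      simp only [this])

/-- The exponents `(a, b)` of the monomials `xᵃ yᵇ` of degree at most `n`. -/
abbrev JetIndex (n : ℕ) : Type := {p : Fin (n + 1) × Fin (n + 1) // (p.1 : ℕ) + (p.2 : ℕ) ≤ n}

/-- The `n`-jet of a germ, as the vector of its Taylor coefficients of degree at most `n`. -/
noncomputable def jet (n : ℕ) (g : HolGerm) : JetIndex n → ℂ :=
  fun p => taylorCoeff p.1.1 p.1.2 (g : Germ (𝓝 (0 : ℂ × ℂ)) ℂ)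

/-- A parametrised arc: a holomorphic map germ `(ℂ, 0) → (ℂ², 0)`. -/
structure Arc where
  toFun : ℂ → ℂ × ℂ
  analyticAt : AnalyticAt ℂ toFun 0
  map_zero : toFun 0 = 0

theorem Arc.tendsto (γ : Arc) : Tendsto γ.toFun (𝓝 0) (𝓝 0) := by
  have h := γ.analyticAt.continuousAt.tendsto
  rwa [γ.map_zero] at h

/-- `Ord₀ f(γ(t))`, with value `⊤` if `f ∘ γ` vanishes identically near `0`. -/
noncomputable def ordAlong (γ : Arc) (g : Germ (𝓝 (0 : ℂ × ℂ)) ℂ) : ℕ∞ :=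
  Quotient.liftOn g (fun f => analyticOrderAt (fun t => f (γ.toFun t)) 0)
    (fun _ _ h => analyticOrderAt_congr (γ.tendsto.eventually h))

/-- `γ` is a family of uniformisations of the irreducible components of the germ at the origin of
the curve `C`, one for each component: the arcs run in `C`, are injective with images meeting
only at the origin, and together they fill a neighbourhood of the origin in `C`. -/
structure IsUniformization {ι : Type} (C : Set (ℂ × ℂ)) (γ : ι → Arc) : Prop where
  mem : ∀ i, ∀ᶠ t in 𝓝 (0 : ℂ), (γ i).toFun t ∈ C
  injective : ∃ U ∈ 𝓝 (0 : ℂ), ∀ i j, ∀ s ∈ U, ∀ t ∈ U, (γ i).toFun s = (γ j).toFun t →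
    (i = j ∧ s = t) ∨ (s = 0 ∧ t = 0)
  fills : ∀ U ∈ 𝓝 (0 : ℂ), (⋃ i, (γ i).toFun '' U) ∈ 𝓝[C] (0 : ℂ × ℂ)

/-! ### The motivic measure on `ℙ𝒪` and the motivic integral -/

/-- The preimage of a set of `n`-jets under the (partially defined) map `ℙ𝒪 ⇢ ℙ(jₙ𝒪)`. -/
def cylinder (n : ℕ) (Y : Set (Projectivization ℂ (JetIndex n → ℂ))) :
    Set (Projectivization ℂ HolGerm) :=
  {x | ∃ h : jet n x.rep ≠ 0, Projectivization.mk ℂ (jet n x.rep) h ∈ Y}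

/-- `HasMeasure A m`: the set `A ⊆ ℙ𝒪` is cylindric, `A = πₙ⁻¹(Y)` with `Y ⊆ ℙ(jₙ𝒪)`
constructible, and its motivic measure is `m = [Y] 𝕃^(-dim ℙ(jₙ𝒪))`, where
`dim ℙ(jₙ𝒪) = (n+1)(n+2)/2 - 1`. -/
def HasMeasure (A : Set (Projectivization ℂ HolGerm)) (m : K0Loc) : Prop :=
  ∃ (n : ℕ) (Y : Set (Projectivization ℂ (JetIndex n → ℂ))) (c : K0),
    HasClass Y c ∧ A = cylinder n Y ∧
      m = algebraMap K0 K0Loc c * qMot ^ ((n + 1) * (n + 2) / 2 - 1)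

/-- The set of points of `ℙ𝒪` represented by the germs with orders `v` along the arcs `γ`. -/
def levelSet {ι : Type} (γ : ι → Arc) (v : ι →₀ ℕ) : Set (Projectivization ℂ HolGerm) :=
  {x | ∀ i, ordAlong (γ i) (x.rep : Germ (𝓝 (0 : ℂ × ℂ)) ℂ) = (v i : ℕ∞)}

/-- `P` is the motivic integral `∫_{ℙ𝒪} ∏ tᵢ ^ vᵢ dμ` (with `t ^ ∞ = 0`), that is, the sum over
`v` of the measure of the set of germs with orders `v`, times `t ^ v`. -/
def IsMotivicPoincareSeries {ι : Type} (γ : ι → Arc) (P : MvPowerSeries ι K0Loc) : Prop :=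
  ∀ v : ι →₀ ℕ, HasMeasure (levelSet γ v) (MvPowerSeries.coeff v P)

/-! ### The motivic Poincaré series through the multi-index filtration -/

/-- `J_v = {f ∈ 𝒪 | Ord₀ f(γᵢ(t)) ≥ vᵢ for all i}`, for `v ∈ ℤ^r`. -/
noncomputable def filtration {ι : Type} (γ : ι → Arc) (v : ι → ℤ) : Submodule ℂ HolGerm where
  carrier := {g | ∀ i, ((v i).toNat : ℕ∞) ≤ ordAlong (γ i) (g : Germ (𝓝 (0 : ℂ × ℂ)) ℂ)}
  add_mem' := by
    rintro ⟨_, f, hf, rfl⟩ ⟨_, g, hg, rfl⟩ h1 h2 i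
    exact le_trans (le_min (h1 i) (h2 i)) le_analyticOrderAt_add
  zero_mem' := by
    intro i
    have : ordAlong (γ i) ((0 : HolGerm) : Germ (𝓝 (0 : ℂ × ℂ)) ℂ) = ⊤ :=
      analyticOrderAt_eq_top.2 (Eventually.of_forall fun _ => rfl)
    rw [this]
    exact le_top
  smul_mem' := by
    rintro c ⟨_, f, hf, rfl⟩ h1 i
    have hfγ : AnalyticAt ℂ (fun t => f ((γ i).toFun t)) 0 :=
      AnalyticAt.fun_comp (by rw [(γ i).map_zero]; exact hf) (γ i).analyticAt
    have key : analyticOrderAt (fun t => f ((γ i).toFun t)) 0 ≤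
        analyticOrderAt ((fun _ : ℂ => c) * fun t => f ((γ i).toFun t)) 0 := by
      rw [analyticOrderAt_mul analyticAt_const hfγ]
      exact le_add_self
    exact le_trans (h1 i) key

/-- `h(v) = codim J_v`. -/
noncomputable def codim {ι : Type} (γ : ι → Arc) (v : ι → ℤ) : ℕ :=
  Module.finrank ℂ (HolGerm ⧸ filtration γ v)

/-- The coefficient `(q^h(v) - q^h(v+1)) / (1 - q)` of `t ^ v`, `v ∈ ℤ^r`, in the two-sided
series `L_g`; here `q` is a formal variable. -/
noncomputable def coeffL {ι : Type} (γ : ι → Arc) (v : ι → ℤ) : RatFunc ℚ :=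
  (RatFunc.X ^ codim γ v - RatFunc.X ^ codim γ (v + 1)) / (1 - RatFunc.X)

/-- The coefficients of a power series, extended by zero to exponents in `ℤ^r`. -/
noncomputable def intCoeff {ι R : Type} [Fintype ι] [CommRing R] (P : MvPowerSeries ι R)
    (v : ι → ℤ) : R :=
  open Classical in
  if ∀ i, 0 ≤ v i then MvPowerSeries.coeff (Finsupp.equivFunOnFinite.symm fun i => (v i).toNat) P
  else 0

/-- `P` is the power series `L_g · ∏ (tᵢ - 1) / (∏ tᵢ - 1)`: all codimensions are finite, and
`P · (∏ tᵢ - 1) = L_g · ∏ (tᵢ - 1)`, coefficient by coefficient in `ℤ^r`. -/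
def IsFiltrationPoincareSeries {ι : Type} [Fintype ι] (γ : ι → Arc)
    (P : MvPowerSeries ι (RatFunc ℚ)) : Prop :=
  (∀ v : ι → ℤ, Module.Finite ℂ (HolGerm ⧸ filtration γ v)) ∧
  ∀ v : ι → ℤ, intCoeff P (v - 1) - intCoeff P v =
    ∑ I : Finset ι, (-1) ^ (Fintype.card ι - I.card) *
      coeffL γ (v - Set.indicator (I : Set ι) 1)

/-! ### The explicit series -/

/-- `∑_{k<n} q^k (t₁t₂)^k + q^n (1-q) (t₁t₂)^n / ((1 - q t₁)(1 - q t₂))`, over a ring `R`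
containing `q`. -/
noncomputable def seriesA {R : Type*} [CommRing R] (q : R) (n : ℕ) : MvPowerSeries (Fin 2) R :=
  let C : R →+* MvPowerSeries (Fin 2) R := MvPowerSeries.C
  let t₁ : MvPowerSeries (Fin 2) R := MvPowerSeries.X 0
  let t₂ : MvPowerSeries (Fin 2) R := MvPowerSeries.X 1
  ∑ k ∈ Finset.range n, C (q ^ k) * (t₁ * t₂) ^ k +
    C (q ^ n * (1 - q)) * (t₁ * t₂) ^ n *
      MvPowerSeries.invOfUnit ((1 - C q * t₁) * (1 - C q * t₂)) 1

end MotivicPoincare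

namespace MotivicPoincare

/-! The equation factors as `(y - x^n)(y + x^n) = 0`, and the two arcs parametrise the branches `y =
εx^n` and `y = -εx^n`, `ε = ±1`, each by a local coordinate (`exists_branchParam`). So `v₁(f)` and
`v₂(f)` are the orders in `x` of `f(x, εx^n)` and `f(x, -εx^n)`, and bounding them below means that
linear forms `branchCoeff` vanish on a jet of `f` (`natCast_le_ordAlong_iff`). For `k < n` the two
coefficients of `x^k` coincide; for `k ≥ n` they are independent, thanks to `x^k` and `x^(k-n) y`.
Hence `h(a, b) = max(a, b) + max(min(a, b) - n, 0)` for `a, b ≥ 0`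
(`finrank_quotient_jetFiltration`).

For the motivic integral, the level set of `(a, b)` lies over a projective space of jets minus two
hyperplanes. If `a, b ≥ n` the hyperplanes differ and the class is `𝕃^(d+1) - 𝕃^d`; if `a = b < n`
they coincide and the class is `𝕃^d`; otherwise the set is empty. Normalising gives the coefficients
`coeffA` (`hasMeasure_levelSet`).

For the filtration, `(1 - q)` times the coefficient at `v` is the mixed second difference of `q^h`
at `v` (`coeffA_mul_one_sub`, `intCoeff_seriesA_mul`); differencing once more along `(1, 1)` gives
the required identity. -/

/-! ### Orders of vanishing in one variable. -/

theorem natCast_le_analyticOrderAt_iff_isBigO {f : ℂ → ℂ} (hf : AnalyticAt ℂ f 0) (v : ℕ) :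
    (v : ℕ∞) ≤ analyticOrderAt f 0 ↔ f =O[𝓝 0] (fun t : ℂ => t ^ v) := by
  constructor
  · intro h
    obtain ⟨g, hg, hfg⟩ := (natCast_le_analyticOrderAt hf).1 h
    have h1 : (fun t : ℂ => t ^ v * g t) =O[𝓝 0] (fun t : ℂ => t ^ v * 1) :=
      (Asymptotics.isBigO_refl _ _).mul (hg.continuousAt.tendsto.isBigO_one ℂ)
    simp only [mul_one] at h1
    refine h1.congr' ?_ (EventuallyEq.refl _ _)
    filter_upwards [hfg] with t ht
    simp [ht]
  · intro h
    by_contra hlt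
    rw [not_le] at hlt
    obtain ⟨m, hm⟩ := ENat.ne_top_iff_exists.1 (ne_top_of_lt hlt)
    rw [← hm] at hlt
    have hmv : m < v := by exact_mod_cast hlt
    obtain ⟨g, hg, hg0, hfg⟩ := (hf.analyticOrderAt_eq_natCast).1 hm.symm
    obtain ⟨C, hC⟩ := h.bound
    have h2 : ∀ᶠ t in 𝓝[≠] (0 : ℂ), ‖g t‖ ≤ C * ‖t‖ ^ (v - m) := by
      filter_upwards [hC.filter_mono nhdsWithin_le_nhds, hfg.filter_mono nhdsWithin_le_nhds,
        self_mem_nhdsWithin] with t h1 h3 h4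
      have h5 : 0 < ‖t‖ ^ m := pow_pos (norm_pos_iff.2 h4) m
      rw [h3] at h1
      simp only [sub_zero, smul_eq_mul, norm_mul, norm_pow] at h1
      have h6 : ‖t‖ ^ v = ‖t‖ ^ m * ‖t‖ ^ (v - m) := by rw [← pow_add]; congr 1; omega
      rw [h6] at h1
      have : ‖t‖ ^ m * ‖g t‖ ≤ ‖t‖ ^ m * (C * ‖t‖ ^ (v - m)) := by linarith
      exact le_of_mul_le_mul_left this h5
    have h7 : Tendsto (fun t => ‖g t‖) (𝓝[≠] (0 : ℂ)) (𝓝 ‖g 0‖) :=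
      (hg.continuousAt.norm.tendsto).mono_left nhdsWithin_le_nhds
    have h8 : Tendsto (fun t : ℂ => C * ‖t‖ ^ (v - m)) (𝓝[≠] (0 : ℂ)) (𝓝 0) := by
      have : Continuous (fun t : ℂ => C * ‖t‖ ^ (v - m)) := by fun_prop
      have h9 := this.tendsto 0
      simp only [norm_zero, zero_pow (Nat.sub_ne_zero_of_lt hmv), mul_zero] at h9
      exact h9.mono_left nhdsWithin_le_nhds
    have := le_of_tendsto_of_tendsto h7 h8 h2
    exact hg0 (norm_le_zero_iff.1 this)

theorem natCast_le_analyticOrderAt_polynomial (p : Polynomial ℂ) (v : ℕ) :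
    (v : ℕ∞) ≤ analyticOrderAt (fun t : ℂ => p.eval t) 0 ↔ ∀ j < v, p.coeff j = 0 := by
  have han : ∀ q : Polynomial ℂ, AnalyticAt ℂ (fun t : ℂ => q.eval t) 0 := fun q => by
    simpa using AnalyticAt.aeval_polynomial (f := fun t : ℂ => t) analyticAt_id q
  constructor
  · intro h j
    induction j using Nat.strong_induction_on with
    | _ j ih =>
      intro hj
      by_contra hne
      have h1 : Polynomial.X ^ j ∣ p :=
        Polynomial.X_pow_dvd_iff.2 fun i hi => ih i hi (hi.trans hj)
      obtain ⟨q, rfl⟩ := h1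
      have hq : q.eval 0 ≠ 0 := by
        rw [← Polynomial.coeff_zero_eq_eval_zero]
        rwa [Polynomial.coeff_X_pow_mul', if_pos le_rfl, Nat.sub_self] at hne
      have h2 : analyticOrderAt (fun t : ℂ => (Polynomial.X ^ j * q).eval t) 0 = (j : ℕ∞) :=
        ((han _).analyticOrderAt_eq_natCast).2 ⟨fun t => q.eval t, han q, hq,
          Eventually.of_forall fun t => by simp⟩
      rw [h2] at h
      have : v ≤ j := by exact_mod_cast h
      omega
  · intro h
    obtain ⟨q, rfl⟩ := Polynomial.X_pow_dvd_iff.2 h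
    exact (natCast_le_analyticOrderAt (han _)).2
      ⟨fun t => q.eval t, han q, Eventually.of_forall fun t => by simp⟩

theorem polynomial_eq_zero_of_isBigO (p : Polynomial ℂ) (v : ℕ) (hv : p.natDegree < v)
    (h : (fun t : ℂ => p.eval t) =O[𝓝 0] (fun t : ℂ => t ^ v)) : p = 0 := by
  have han : AnalyticAt ℂ (fun t : ℂ => p.eval t) 0 := by
    simpa using AnalyticAt.aeval_polynomial (f := fun t : ℂ => t) analyticAt_id p
  have h1 := (natCast_le_analyticOrderAt_polynomial p v).1
    ((natCast_le_analyticOrderAt_iff_isBigO han v).2 h)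
  ext j
  by_cases hj : j < v
  · simpa using h1 j hj
  · simpa using Polynomial.coeff_eq_zero_of_natDegree_lt (by omega)

/-! ### Jets and Taylor polynomials in two variables. -/

/-- Groups the monomials by total degree `m`, as a power series expansion delivers them; `k` is the
exponent of `x`. -/
theorem sum_jetIndex {M : Type*} [AddCommMonoid M] (N : ℕ) (F : ℕ → ℕ → M) :
    ∑ p : JetIndex N, F p.1.1 p.1.2 =
      ∑ m ∈ Finset.range (N + 1), ∑ k ∈ Finset.range (m + 1), F k (m - k) := by
  rw [Finset.sum_sigma']
  refine Finset.sum_bij'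
    (fun p _ => (⟨(p.1.1 : ℕ) + p.1.2, p.1.1⟩ : (_ : ℕ) × ℕ))
    (fun s hs => ⟨(⟨s.2, ?_⟩, ⟨s.1 - s.2, ?_⟩), ?_⟩) ?_ ?_ ?_ ?_ ?_
  · simp at hs; omega
  · simp at hs; omega
  · simp at hs; simp; omega
  · rintro ⟨p, hp⟩ -
    simp; omega
  · simp
  · rintro ⟨p, hp⟩ -
    simp
  · rintro ⟨m, k⟩ hs
    simp at hs
    simp; omega
  · rintro ⟨p, hp⟩ -
    simp

theorem card_jetIndex (N : ℕ) : Fintype.card (JetIndex N) = (N + 1) * (N + 2) / 2 := by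
  have h := sum_jetIndex N (fun _ _ => 1)
  simp only [Finset.sum_const, Finset.card_univ, Finset.card_range, smul_eq_mul, mul_one] at h
  rw [h]
  have h2 : ∀ N : ℕ, (∑ m ∈ Finset.range (N + 1), (m + 1)) * 2 = (N + 1) * (N + 2) := by
    intro N
    induction N with
    | zero => simp
    | succ k ih => rw [Finset.sum_range_succ, add_mul, ih]; ring
  rw [← h2 N]; simp

/-- The polynomial function with given coefficients in degree at most `N`. -/
noncomputable def jetEval (N : ℕ) (c : JetIndex N → ℂ) (z : ℂ × ℂ) : ℂ :=
  ∑ p, c p * (z.1 ^ (p.1.1 : ℕ) * z.2 ^ (p.1.2 : ℕ))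

/-- Serves to sort the arguments of a symmetric multilinear map so that the copies of `(1, 0)` come
first, as in `taylorCoeff`. -/
theorem exists_perm_mem_iff {m : ℕ} (s : Finset (Fin m)) :
    ∃ σ : Equiv.Perm (Fin m), ∀ i, σ i ∈ s ↔ (i : ℕ) < s.card := by
  have hs : s.card ≤ m := by simpa using s.card_le_univ
  have hcard : Fintype.card {i : Fin m // (i : ℕ) < s.card} = Fintype.card {i // i ∈ s} := by
    rw [Fintype.card_coe, Fintype.card_subtype]
    have : (Finset.univ.filter fun i : Fin m => (i : ℕ) < s.card).card
        = (Finset.range s.card).card := by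
      refine Finset.card_bij (fun i _ => (i : ℕ)) (by simp) (fun a _ b _ h => Fin.ext h) ?_
      intro b hb
      rw [Finset.mem_range] at hb
      exact ⟨⟨b, by omega⟩, by simpa using hb, rfl⟩
    simpa using this
  let e := Fintype.equivOfCardEq hcard
  refine ⟨e.extendSubtype, fun i => ⟨fun h => ?_, fun h => e.extendSubtype_mem i h⟩⟩
  by_contra hi
  exact e.extendSubtype_not_mem i hi h

/-- A binomial expansion: multilinearity gives a sum over the sets `s` of slots filled with `z.1 •
(1, 0)`, and by symmetry each term depends only on `s.card`. -/
theorem multilinear_apply_diagonal {m : ℕ} (D : (ℂ × ℂ) [×m]→L[ℂ] ℂ)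
    (hD : ∀ (v : Fin m → ℂ × ℂ) (σ : Equiv.Perm (Fin m)), D (v ∘ σ) = D v) (z : ℂ × ℂ) :
    D (fun _ => z) = ∑ k ∈ Finset.range (m + 1), (m.choose k : ℂ) *
      (z.1 ^ k * z.2 ^ (m - k) *
        D (fun i => if (i : ℕ) < k then ((1, 0) : ℂ × ℂ) else (0, 1))) := by
  have hz : (fun _ : Fin m => z) =
      (fun _ => z.1 • ((1, 0) : ℂ × ℂ)) + (fun _ => z.2 • ((0, 1) : ℂ × ℂ)) := by
    funext i; ext <;> simp
  rw [hz, D.map_add_univ]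
  have key : ∀ s : Finset (Fin m), D (s.piecewise (fun _ => z.1 • ((1, 0) : ℂ × ℂ))
      (fun _ => z.2 • ((0, 1) : ℂ × ℂ))) = z.1 ^ s.card * z.2 ^ (m - s.card) *
        D (fun i => if (i : ℕ) < s.card then ((1, 0) : ℂ × ℂ) else (0, 1)) := by
    intro s
    obtain ⟨σ, hσ⟩ := exists_perm_mem_iff s
    have h1 : s.piecewise (fun _ => z.1 • ((1, 0) : ℂ × ℂ)) (fun _ => z.2 • ((0, 1) : ℂ × ℂ)) =
        fun i => (if i ∈ s then z.1 else z.2) •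
          (if i ∈ s then ((1, 0) : ℂ × ℂ) else (0, 1)) := by
      funext i
      by_cases hi : i ∈ s <;> simp [hi]
    rw [h1, D.map_smul_univ, Finset.prod_ite]
    have h2 : (Finset.univ.filter fun i => i ∉ s).card = m - s.card := by
      rw [Finset.filter_not, Finset.card_sdiff]; simp
    simp only [Finset.prod_const, h2, Finset.filter_mem_eq_inter, Finset.univ_inter, smul_eq_mul]
    rw [← hD _ σ]
    congr 2
    funext i
    simp [hσ i]
  simp_rw [key]
  rw [← Finset.powerset_univ, Finset.sum_powerset_apply_card (fun k => z.1 ^ k * z.2 ^ (m - k) *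
        D (fun i => if (i : ℕ) < k then ((1, 0) : ℂ × ℂ) else (0, 1)))]
  simp

/-- The term of degree `m` in the power series is the `m`-th derivative on the diagonal over `m!`;
the binomial coefficient turns `1 / m!` into the `1 / (k! l!)` of `taylorCoeff`. -/
theorem isBigO_sub_taylor {f : ℂ × ℂ → ℂ} (hf : AnalyticAt ℂ f 0) (N : ℕ) :
    (fun z => f z - jetEval N (fun p => taylorCoeff p.1.1 p.1.2
      (f : Germ (𝓝 (0 : ℂ × ℂ)) ℂ)) z) =O[𝓝 0] (fun z => ‖z‖ ^ (N + 1)) := by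
  obtain ⟨p, hp⟩ := hf
  obtain ⟨r, hr⟩ := id hp
  have h := hp.isBigO_sub_partialSum_pow (N + 1)
  simp only [zero_add] at h
  refine h.congr_left fun z => ?_
  congr 1
  rw [FormalMultilinearSeries.partialSum, jetEval,
    sum_jetIndex N (fun a b => taylorCoeff a b (f : Germ (𝓝 (0 : ℂ × ℂ)) ℂ) * (z.1 ^ a * z.2 ^ b))]
  refine Finset.sum_congr rfl fun m _ => ?_
  have h1 := hr.factorial_smul z m
  have hfac : (m.factorial : ℂ) ≠ 0 := by exact_mod_cast m.factorial_ne_zero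
  have h2 : p m (fun _ => z) = (m.factorial : ℂ)⁻¹ * iteratedFDeriv ℂ m f 0 (fun _ => z) := by
    rw [← h1, nsmul_eq_mul, inv_mul_cancel_left₀ hfac]
  rw [h2, multilinear_apply_diagonal _ (fun v σ =>
    hp.analyticAt.contDiffAt.iteratedFDeriv_comp_perm v σ), Finset.mul_sum]
  refine Finset.sum_congr rfl fun k hk => ?_
  have hk' : k ≤ m := by simpa [Nat.lt_succ_iff] using hk
  obtain ⟨l, rfl⟩ := Nat.exists_eq_add_of_le hk'
  rw [Nat.add_sub_cancel_left]
  have h3 : taylorCoeff k l (f : Germ (𝓝 (0 : ℂ × ℂ)) ℂ) = iteratedFDeriv ℂ (k + l) f 0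
      (fun i : Fin (k + l) => if (i : ℕ) < k then ((1, 0) : ℂ × ℂ) else (0, 1)) /
        ((k.factorial : ℂ) * (l.factorial : ℂ)) := rfl
  rw [h3]
  have h4 := Nat.add_choose_mul_factorial_mul_factorial k l
  have h5 : ((k + l).choose k : ℂ) * k.factorial * l.factorial = (k + l).factorial := by
    rw [Nat.choose_symm_add]; exact_mod_cast h4
  have hk0 : (k.factorial : ℂ) ≠ 0 := by exact_mod_cast k.factorial_ne_zero
  have hl0 : (l.factorial : ℂ) ≠ 0 := by exact_mod_cast l.factorial_ne_zero
  field_simp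
  rw [← h5]
  ring

theorem jetEval_add (N : ℕ) (c d : JetIndex N → ℂ) (z : ℂ × ℂ) :
    jetEval N (c + d) z = jetEval N c z + jetEval N d z := by
  simp [jetEval, add_mul, Finset.sum_add_distrib]

theorem jetEval_smul (N : ℕ) (a : ℂ) (c : JetIndex N → ℂ) (z : ℂ × ℂ) :
    jetEval N (a • c) z = a * jetEval N c z := by
  simp [jetEval, mul_assoc, Finset.mul_sum]

theorem jetEval_sub (N : ℕ) (c d : JetIndex N → ℂ) (z : ℂ × ℂ) :
    jetEval N (c - d) z = jetEval N c z - jetEval N d z := by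
  simp [jetEval, sub_mul, Finset.sum_sub_distrib]

theorem analyticAt_jetEval (N : ℕ) (c : JetIndex N → ℂ) : AnalyticAt ℂ (jetEval N c) 0 := by
  have : jetEval N c = fun z => ∑ p, c p * (z.1 ^ (p.1.1 : ℕ) * z.2 ^ (p.1.2 : ℕ)) := rfl
  rw [this]
  exact Finset.analyticAt_fun_sum _ fun p _ =>
    analyticAt_const.mul ((analyticAt_fst.pow _).mul (analyticAt_snd.pow _))

/-- Restrict to the curve `s ↦ (s^(N+1), s^(N+2))`. There `x^a y^b` becomes `s` to the power
`(N+1)(a+b) + b`. Since `b ≤ N`, division by `N+1` recovers `b` and `a+b`, so distinct monomials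
stay distinct. All exponents are below `(N+1)^2`, the order of vanishing that the hypothesis forces.
-/
theorem eq_zero_of_jetEval_isBigO (N : ℕ) (d : JetIndex N → ℂ)
    (h : jetEval N d =O[𝓝 0] (fun z => ‖z‖ ^ (N + 1))) : d = 0 := by
  set e : JetIndex N → ℕ := fun p => (N + 1) * p.1.1 + (N + 2) * p.1.2 with he
  have he_inj : ∀ p p' : JetIndex N, e p = e p' → p = p' := by
    rintro ⟨⟨a, b⟩, h1⟩ ⟨⟨a', b'⟩, h2⟩ h3
    simp only [he] at h3 h1 h2
    have h4 : ((a : ℕ) + b) * (N + 1) + b = ((a' : ℕ) + b') * (N + 1) + b' := by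
      ring_nf at h3 ⊢; omega
    have hb : (b : ℕ) = b' := by
      have := congrArg (· % (N + 1)) h4
      simpa [Nat.mul_add_mod_self_right, Nat.mod_eq_of_lt b.2, Nat.mod_eq_of_lt b'.2] using this
    rw [hb] at h4
    have h5 : (a : ℕ) + b' = a' + b' :=
      Nat.eq_of_mul_eq_mul_right (Nat.succ_pos N) (Nat.add_right_cancel h4)
    have ha : (a : ℕ) = a' := by omega
    simp [Fin.ext_iff, ha, hb]
  set P : Polynomial ℂ := ∑ p, Polynomial.monomial (e p) (d p) with hP
  have heval : ∀ s : ℂ, P.eval s = jetEval N d (s ^ (N + 1), s ^ (N + 2)) := by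
    intro s
    simp only [hP, Polynomial.eval_finsetSum, Polynomial.eval_monomial, jetEval, he, pow_add,
      pow_mul]
  have hdeg : P.natDegree < (N + 1) * (N + 1) := by
    refine lt_of_le_of_lt (Polynomial.natDegree_sum_le_of_forall_le (n := (N + 1) * (N + 1) - 1)
      _ _ fun p _ => (Polynomial.natDegree_monomial_le _).trans ?_) (by simp)
    obtain ⟨⟨a, b⟩, h1⟩ := p
    simp only [he] at h1 ⊢
    have h4 : (N + 1) * (a : ℕ) + (N + 2) * b = (a + b) * (N + 1) + b := by ring
    have h5 : ((a : ℕ) + b) * (N + 1) ≤ N * (N + 1) := Nat.mul_le_mul_right _ h1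
    have h6 : (N + 1) * (N + 1) = N * (N + 1) + N + 1 := by ring
    omega
  have hcont : Tendsto (fun s : ℂ => (s ^ (N + 1), s ^ (N + 2))) (𝓝 0) (𝓝 (0 : ℂ × ℂ)) := by
    have : Continuous (fun s : ℂ => (s ^ (N + 1), s ^ (N + 2))) := by fun_prop
    have h1 := this.tendsto 0
    simpa [← Prod.zero_eq_mk] using h1
  have hO : (fun s : ℂ => P.eval s) =O[𝓝 0] (fun s : ℂ => s ^ ((N + 1) * (N + 1))) := by
    have h1 := h.comp_tendsto hcont
    have h2 : (fun s : ℂ => P.eval s) = jetEval N d ∘ fun s : ℂ => (s ^ (N + 1), s ^ (N + 2)) :=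
      funext heval
    rw [h2]
    refine h1.trans (Asymptotics.IsBigO.of_bound 1 ?_)
    filter_upwards [Metric.ball_mem_nhds (0 : ℂ) one_pos] with s hs
    have hs1 : ‖s‖ ≤ 1 := by simpa using (mem_ball_zero_iff.1 hs).le
    simp only [Function.comp, norm_pow, norm_norm, one_mul, pow_mul]
    gcongr
    rw [Prod.norm_def]
    refine max_le (by simp) ?_
    simpa using pow_le_pow_of_le_one (norm_nonneg s) hs1 (Nat.le_succ (N + 1))
  have hP0 := polynomial_eq_zero_of_isBigO P _ hdeg hO
  funext p
  have h1 : P.coeff (e p) = d p := by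
    rw [hP, Polynomial.finsetSum_coeff, Finset.sum_eq_single p]
    · simp
    · intro q _ hq
      rw [Polynomial.coeff_monomial, if_neg fun h => hq (he_inj _ _ h)]
    · simp
  rw [← h1, hP0]; simp

theorem isBigO_sub_jet (N : ℕ) (g : HolGerm) {f : ℂ × ℂ → ℂ} (hf : AnalyticAt ℂ f 0)
    (hg : (g : Germ (𝓝 (0 : ℂ × ℂ)) ℂ) = (f : Germ (𝓝 (0 : ℂ × ℂ)) ℂ)) :
    (fun z => f z - jetEval N (jet N g) z) =O[𝓝 0] (fun z => ‖z‖ ^ (N + 1)) := by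
  have h := isBigO_sub_taylor hf N
  rw [← hg] at h
  exact h

/-- Characterises the jet by its order of approximation, so that linearity and surjectivity of the
jet map need no computation with derivatives. -/
theorem jet_eq_of_isBigO (N : ℕ) (g : HolGerm) {f : ℂ × ℂ → ℂ} (hf : AnalyticAt ℂ f 0)
    (hg : (g : Germ (𝓝 (0 : ℂ × ℂ)) ℂ) = (f : Germ (𝓝 (0 : ℂ × ℂ)) ℂ)) (c : JetIndex N → ℂ)
    (h : (fun z => f z - jetEval N c z) =O[𝓝 0] (fun z => ‖z‖ ^ (N + 1))) : jet N g = c := by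
  refine sub_eq_zero.1 (eq_zero_of_jetEval_isBigO N _ ?_)
  refine (h.sub (isBigO_sub_jet N g hf hg)).congr_left fun z => ?_
  rw [jetEval_sub]; ring

/-- The jet map as a linear map. -/
noncomputable def jetLin (N : ℕ) : HolGerm →ₗ[ℂ] (JetIndex N → ℂ) where
  toFun := jet N
  map_add' := by
    rintro ⟨_, f, hf, rfl⟩ ⟨_, g, hg, rfl⟩
    refine jet_eq_of_isBigO N _ (hf.add hg) rfl _ ?_
    refine ((isBigO_sub_jet N ⟨_, f, hf, rfl⟩ hf rfl).add
      (isBigO_sub_jet N ⟨_, g, hg, rfl⟩ hg rfl)).congr_left fun z => ?_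
    rw [jetEval_add]; simp only [Pi.add_apply]; ring
  map_smul' := by
    rintro a ⟨_, f, hf, rfl⟩
    refine jet_eq_of_isBigO N _ (hf.const_smul (c := a)) rfl _ ?_
    refine ((isBigO_sub_jet N ⟨_, f, hf, rfl⟩ hf rfl).const_mul_left a).congr_left fun z => ?_
    rw [RingHom.id_apply, jetEval_smul]; simp only [Pi.smul_apply, smul_eq_mul]; ring

theorem jetLin_surjective (N : ℕ) : Function.Surjective (jetLin N) := by
  intro c
  let g : HolGerm := ⟨_, jetEval N c, analyticAt_jetEval N c, rfl⟩
  refine ⟨g, jet_eq_of_isBigO N g (analyticAt_jetEval N c) rfl c ?_⟩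
  simpa using Asymptotics.isBigO_zero _ _

/-! ### Local injectivity and order one. -/

/-- An injective holomorphic germ in one variable has order one. -/
theorem analyticOrderAt_eq_one_of_injOn {f : ℂ → ℂ} (hf : AnalyticAt ℂ f 0) (hf0 : f 0 = 0)
    {U : Set ℂ} (hU : U ∈ 𝓝 (0 : ℂ)) (hinj : Set.InjOn f U) : analyticOrderAt f 0 = 1 := by
  have hnc : ∀ g : ℂ → ℂ, (∀ᶠ t in 𝓝 0, g t = g 0) → ∃ t ∈ U, t ≠ 0 ∧ g t = g 0 := by
    intro g hg
    obtain ⟨t, ht, ht0⟩ := ((hg.and hU).filter_mono nhdsWithin_le_nhds |>.and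
      (self_mem_nhdsWithin (a := (0 : ℂ)) (s := {0}ᶜ))).exists
    exact ⟨t, ht.2, ht0, ht.1⟩
  have hU0 : (0 : ℂ) ∈ U := mem_of_mem_nhds hU
  have htop : analyticOrderAt f 0 ≠ ⊤ := by
    intro h
    rw [analyticOrderAt_eq_top] at h
    obtain ⟨t, htU, ht0, ht⟩ := hnc f (by simpa [hf0] using h)
    exact ht0 (hinj htU hU0 ht)
  obtain ⟨m, hm⟩ := ENat.ne_top_iff_exists.1 htop
  rw [← hm]
  have hm0 : m ≠ 0 := by
    rintro rfl
    rcases analyticOrderAt_eq_zero.1 hm.symm with h | h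
    exacts [h hf, h hf0]
  by_contra hm1
  have hm1' : m ≠ 1 := fun h => hm1 (by simp [h])
  obtain ⟨g, hg, hg0, hfg⟩ := (hf.analyticOrderAt_eq_natCast).1 hm.symm
  -- For `m ≥ 2` an `m`-th root `h` of `f` near `0` is built. The principal power is applied to `g t
  -- / g 0`, which is near `1` and so in the slit plane; `c` restores the factor `g 0`.
  obtain ⟨c, hc⟩ : ∃ c : ℂ, c ^ m = g 0 := IsAlgClosed.exists_pow_nat_eq _ (Nat.pos_of_ne_zero hm0)
  have hc0 : c ≠ 0 := by rintro rfl; exact hg0 (by rw [← hc, zero_pow hm0])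
  set h : ℂ → ℂ := fun t => t * (c * (g t / g 0) ^ ((m : ℂ)⁻¹)) with hh
  have hpow : ∀ t, h t ^ m = t ^ m * g t := by
    intro t
    rw [hh]
    simp only [mul_pow, hc]
    rw [Complex.cpow_nat_inv_pow _ hm0, mul_div_cancel₀ _ hg0]
  have hsl : g 0 / g 0 ∈ Complex.slitPlane := by rw [div_self hg0]; simp
  have hhan : AnalyticAt ℂ h 0 :=
    analyticAt_id.mul (analyticAt_const.mul
      ((hg.div analyticAt_const hg0).cpow analyticAt_const hsl))
  have hh0 : h 0 = 0 := by simp [hh]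
  obtain ⟨ζ, hζ⟩ : ∃ ζ : ℂ, IsPrimitiveRoot ζ m := ⟨_, Complex.isPrimitiveRoot_exp m hm0⟩
  have hζ1 : ζ ≠ 1 := hζ.ne_one (by omega)
  have hV : U ∩ {t | f t = (t - 0) ^ m • g t} ∈ 𝓝 (0 : ℂ) := inter_mem hU hfg
  rcases hhan.eventually_constant_or_nhds_le_map_nhds_aux with hconst | hopen
  · obtain ⟨t, ht, ht0⟩ := ((hconst.and hV).filter_mono nhdsWithin_le_nhds |>.and
      (self_mem_nhdsWithin (a := (0 : ℂ)) (s := {0}ᶜ))).exists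
    refine ht0 (hinj ht.2.1 hU0 ?_)
    have h1 : f t = (t - 0) ^ m • g t := ht.2.2
    rw [h1, sub_zero, smul_eq_mul, ← hpow, ht.1, hh0, hf0, zero_pow hm0]
  -- By openness `h` takes both values `s` and `ζ * s` near `0`, at two points where `f` has the
  -- same value `s^m`; injectivity then forces `ζ * s = s`.
  · rw [hh0] at hopen
    have himg : h '' (U ∩ {t | f t = (t - 0) ^ m • g t}) ∈ 𝓝 (0 : ℂ) := hopen (image_mem_map hV)
    have hζt : Tendsto (fun s : ℂ => ζ * s) (𝓝 0) (𝓝 0) := by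
      simpa using (continuous_const_mul ζ).tendsto 0
    obtain ⟨s, hs, hs0⟩ := (((eventually_mem_set.2 himg).and (hζt.eventually himg)).filter_mono nhdsWithin_le_nhds |>.and
      (self_mem_nhdsWithin (a := (0 : ℂ)) (s := {0}ᶜ))).exists
    obtain ⟨⟨t1, ⟨ht1, hf1⟩, hs1⟩, ⟨t2, ⟨ht2, hf2⟩, hs2⟩⟩ := hs
    have hf1' : f t1 = s ^ m := by
      have h1 : f t1 = (t1 - 0) ^ m • g t1 := hf1
      rw [h1, sub_zero, smul_eq_mul, ← hpow, hs1]
    have hf2' : f t2 = s ^ m := by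
      have h1 : f t2 = (t2 - 0) ^ m • g t2 := hf2
      rw [h1, sub_zero, smul_eq_mul, ← hpow, hs2, mul_pow, hζ.pow_eq_one, one_mul]
    have := hinj ht1 ht2 (hf1'.trans hf2'.symm)
    rw [this, hs2] at hs1
    have : (ζ - 1) * s = 0 := by linear_combination hs1
    rcases mul_eq_zero.1 this with h3 | h3
    · exact hζ1 (sub_eq_zero.1 h3)
    · exact hs0 h3

/-! ### The two branches and orders along them. -/

/-- The coefficient of `x ^ k` in `f(x, ε x ^ n)`, as a linear form on the jets of `f`. -/
noncomputable def branchCoeff (n N : ℕ) (ε : ℂ) (k : ℕ) : (JetIndex N → ℂ) →ₗ[ℂ] ℂ :=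
  ∑ p : JetIndex N, if (p.1.1 : ℕ) + n * p.1.2 = k then
    ε ^ (p.1.2 : ℕ) • (LinearMap.proj p : (JetIndex N → ℂ) →ₗ[ℂ] ℂ) else 0

theorem branchCoeff_apply (n N : ℕ) (ε : ℂ) (k : ℕ) (c : JetIndex N → ℂ) :
    branchCoeff n N ε k c = ∑ p : JetIndex N,
      if (p.1.1 : ℕ) + n * p.1.2 = k then ε ^ (p.1.2 : ℕ) * c p else 0 := by
  rw [branchCoeff, LinearMap.sum_apply]
  refine Finset.sum_congr rfl fun p _ => ?_
  split_ifs <;> simp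

/-- Below degree `n` only the pure power `x^k` contributes, and it does not see `ε`. -/
theorem branchCoeff_eq_of_lt {n N k : ℕ} (hk : k < n) (ε ε' : ℂ) :
    branchCoeff n N ε k = branchCoeff n N ε' k := by
  unfold branchCoeff
  refine Finset.sum_congr rfl fun p _ => ?_
  split_ifs with h
  · have hb : (p.1.2 : ℕ) = 0 := by
      by_contra hne
      have : n * 1 ≤ n * (p.1.2 : ℕ) := Nat.mul_le_mul_left n (Nat.one_le_iff_ne_zero.2 hne)
      omega
    simp [hb]
  · rfl

/-- `γ` runs along the smooth branch `y = ε x ^ n`, which it parametrises by a local coordinate. -/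
structure IsBranchParam (n : ℕ) (ε : ℂ) (γ : Arc) : Prop where
  snd_eq : ∀ᶠ t in 𝓝 (0 : ℂ), (γ.toFun t).2 = ε * (γ.toFun t).1 ^ n
  order_fst : analyticOrderAt (fun t => (γ.toFun t).1) 0 = 1

/-- Truncating `f` to its `N`-jet changes `f ∘ γ` by `O(t^(N+1))`, which is harmless as `v ≤ N + 1`.
On the branch the jet becomes a polynomial `Q` in `x` with coefficients `branchCoeff`, and
substituting `x = u(t)` with `u` of order one preserves orders. -/
theorem natCast_le_ordAlong_iff {n : ℕ} {ε : ℂ} {γ : Arc} (hγ : IsBranchParam n ε γ) {N v : ℕ}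
    (hv : v ≤ N + 1) (g : HolGerm) :
    (v : ℕ∞) ≤ ordAlong γ (g : Germ (𝓝 (0 : ℂ × ℂ)) ℂ) ↔
      ∀ j < v, branchCoeff n N ε j (jet N g) = 0 := by
  set c := jet N g with hc
  obtain ⟨f, hf, hg⟩ := g.2
  set Q : Polynomial ℂ := ∑ p : JetIndex N,
    Polynomial.monomial ((p.1.1 : ℕ) + n * p.1.2) (ε ^ (p.1.2 : ℕ) * c p) with hQ
  have hcoeff : ∀ k, Q.coeff k = branchCoeff n N ε k c := by
    intro k
    rw [hQ, Polynomial.finsetSum_coeff, branchCoeff_apply]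
    exact Finset.sum_congr rfl fun p _ => Polynomial.coeff_monomial
  have hQan : ∀ z, AnalyticAt ℂ (fun t : ℂ => Q.eval t) z := fun z => by
    simpa using AnalyticAt.aeval_polynomial (f := fun t : ℂ => t) (z := z) analyticAt_id Q
  set u : ℂ → ℂ := fun t => (γ.toFun t).1 with hu
  have hu0 : u 0 = 0 := by simp [hu, γ.map_zero]
  have huan : AnalyticAt ℂ u 0 := analyticAt_fst.comp γ.analyticAt
  have horder : analyticOrderAt (fun t => Q.eval (u t)) 0 =
      analyticOrderAt (fun t : ℂ => Q.eval t) 0 := by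
    have h := AnalyticAt.analyticOrderAt_comp (f := fun t : ℂ => Q.eval t) (g := u) (z₀ := 0)
      (hQan _) huan
    simp only [hu0, sub_zero] at h
    rw [hγ.order_fst, mul_one] at h
    exact h
  have hφan : AnalyticAt ℂ (fun t => f (γ.toFun t)) 0 :=
    AnalyticAt.fun_comp (by rw [γ.map_zero]; exact hf) γ.analyticAt
  have hψan : AnalyticAt ℂ (fun t => Q.eval (u t)) 0 := AnalyticAt.fun_comp (hQan _) huan
  have hord : ordAlong γ (g : Germ (𝓝 (0 : ℂ × ℂ)) ℂ) =
      analyticOrderAt (fun t => f (γ.toFun t)) 0 := by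
    rw [hg]; rfl
  have hγO : (fun t => γ.toFun t) =O[𝓝 0] (fun t : ℂ => t) := by
    have h := γ.analyticAt.differentiableAt.isBigO_sub
    simpa [γ.map_zero] using h
  have hdiff : (fun t => f (γ.toFun t) - Q.eval (u t)) =O[𝓝 0] (fun t : ℂ => t ^ v) := by
    have h1 := (isBigO_sub_jet N g hf hg).comp_tendsto γ.tendsto
    have h2 : (fun t => ‖γ.toFun t‖ ^ (N + 1)) =O[𝓝 0] (fun t : ℂ => t ^ v) :=
      (hγO.norm_left.pow (N + 1)).trans (by
        obtain ⟨k, hk⟩ := Nat.exists_eq_add_of_le hv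
        rw [hk]
        simp_rw [pow_add]
        have : Continuous fun t : ℂ => t ^ k := by fun_prop
        simpa using (Asymptotics.isBigO_refl (fun t : ℂ => t ^ v) (𝓝 0)).mul
          ((this.tendsto 0).isBigO_one ℂ))
    refine (h1.trans h2).congr' ?_ (EventuallyEq.refl _ _)
    filter_upwards [hγ.snd_eq] with t ht
    simp only [Function.comp]
    congr 1
    rw [hQ, Polynomial.eval_finsetSum, jetEval]
    refine Finset.sum_congr rfl fun p _ => ?_
    rw [Polynomial.eval_monomial, ht]
    simp only [hu]
    ring
  rw [hord, natCast_le_analyticOrderAt_iff_isBigO hφan]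
  simp_rw [← hcoeff]
  rw [← natCast_le_analyticOrderAt_polynomial, ← horder,
    natCast_le_analyticOrderAt_iff_isBigO hψan]
  constructor
  · intro h
    exact (h.sub hdiff).congr_left fun t => by ring
  · intro h
    exact (h.add hdiff).congr_left fun t => by ring

/-- Isolation of zeros places each arc on one factor of `(y - x^n)(y + x^n)`. On a branch `x`
determines the point, so an injective arc has injective first coordinate, hence of order one. The
filling condition prevents both arcs from running along the same branch. -/
theorem exists_branchParam {n : ℕ} (hn : 1 ≤ n) {γ : Fin 2 → Arc}
    (hγ : IsUniformization {p : ℂ × ℂ | p.2 ^ 2 = p.1 ^ (2 * n)} γ) :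
    ∃ ε : ℂ, ε ^ 2 = 1 ∧ IsBranchParam n ε (γ 0) ∧ IsBranchParam n (-ε) (γ 1) := by
  have hn0 : n ≠ 0 := by omega
  have hsnd : ∀ i, ∃ ε : ℂ, (ε = 1 ∨ ε = -1) ∧
      ∀ᶠ t in 𝓝 (0 : ℂ), ((γ i).toFun t).2 = ε * ((γ i).toFun t).1 ^ n := by
    intro i
    have han : AnalyticAt ℂ (fun t => ((γ i).toFun t).2 - ((γ i).toFun t).1 ^ n) 0 :=
      (analyticAt_snd.comp (γ i).analyticAt).sub ((analyticAt_fst.comp (γ i).analyticAt).pow n)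
    rcases han.eventually_eq_zero_or_eventually_ne_zero with h | h
    · refine ⟨1, Or.inl rfl, ?_⟩
      filter_upwards [h] with t ht
      linear_combination ht
    · refine ⟨-1, Or.inr rfl, ?_⟩
      rw [eventually_nhdsWithin_iff] at h
      filter_upwards [h, hγ.mem i] with t ht hC
      by_cases ht0 : t = 0
      · rw [ht0, (γ i).map_zero]; simp [hn0]
      · have hC' : ((γ i).toFun t).2 ^ 2 = ((γ i).toFun t).1 ^ (2 * n) := hC
        have h1 : (((γ i).toFun t).2 - ((γ i).toFun t).1 ^ n) *
            (((γ i).toFun t).2 + ((γ i).toFun t).1 ^ n) = 0 := by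
          rw [mul_comm 2 n, pow_mul] at hC'
          linear_combination hC'
        have h2 := (mul_eq_zero.1 h1).resolve_left (ht ht0)
        linear_combination h2
  choose ε hε hy using hsnd
  obtain ⟨U, hU, hinj⟩ := hγ.injective
  have hbranch : ∀ i, IsBranchParam n (ε i) (γ i) := by
    intro i
    refine ⟨hy i, analyticOrderAt_eq_one_of_injOn (analyticAt_fst.comp (γ i).analyticAt)
      (by simp [(γ i).map_zero]) (inter_mem hU (hy i)) ?_⟩
    rintro s ⟨hs, hs'⟩ t ⟨ht, ht'⟩ hst
    have hs2 : ((γ i).toFun s).2 = ε i * ((γ i).toFun s).1 ^ n := hs'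
    have ht2 : ((γ i).toFun t).2 = ε i * ((γ i).toFun t).1 ^ n := ht'
    have hst1 : ((γ i).toFun s).1 = ((γ i).toFun t).1 := hst
    rcases hinj i i s hs t ht (Prod.ext hst1 (by rw [hs2, ht2, hst1])) with h | h
    · exact h.2
    · rw [h.1, h.2]
  have hsq : ∀ i, ε i ^ 2 = 1 := fun i => by rcases hε i with h | h <;> simp [h]
  have hne : ε 0 ≠ ε 1 := by
    intro heq
    have hall : ∀ i, ε i = ε 0 := fun i => by fin_cases i <;> simp [heq]
    have hV : {t | ∀ i, ((γ i).toFun t).2 = ε i * ((γ i).toFun t).1 ^ n} ∈ 𝓝 (0 : ℂ) :=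
      eventually_all.2 hy
    have hfill := hγ.fills _ hV
    -- Points of the opposite branch tending to the origin: the arcs would have to cover one with `x
    -- ≠ 0`.
    have hp : Tendsto (fun x : ℂ => (x, -ε 0 * x ^ n)) (𝓝 0)
        (𝓝[{p : ℂ × ℂ | p.2 ^ 2 = p.1 ^ (2 * n)}] 0) := by
      refine tendsto_nhdsWithin_iff.2 ⟨?_, Eventually.of_forall fun x => ?_⟩
      · have : Continuous fun x : ℂ => (x, -ε 0 * x ^ n) := by fun_prop
        simpa [← Prod.zero_eq_mk, hn0] using this.tendsto 0
      · simp only [Set.mem_ofPred_eq]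
        rw [mul_pow, neg_sq, hsq, one_mul, ← pow_mul, mul_comm]
    obtain ⟨x, hx, hx0⟩ := ((hp.eventually (eventually_mem_set.2 hfill)).filter_mono
      nhdsWithin_le_nhds |>.and (self_mem_nhdsWithin (a := (0 : ℂ)) (s := {0}ᶜ))).exists
    obtain ⟨i, hi⟩ := Set.mem_iUnion.1 hx
    obtain ⟨t, ht, htx⟩ := hi
    have h1 : ((γ i).toFun t).2 = ε i * ((γ i).toFun t).1 ^ n := ht i
    rw [htx, hall i] at h1
    simp only at h1
    have h2 : ε 0 * x ^ n = 0 := by linear_combination (-1 / 2 : ℂ) * h1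
    have hε0 : ε 0 ≠ 0 := by
      intro h0
      have := hsq 0
      simp [h0] at this
    exact (mul_ne_zero hε0 (pow_ne_zero n hx0)) h2
  refine ⟨ε 0, hsq 0, hbranch 0, ?_⟩
  have h1 : -ε 0 = ε 1 := by
    rcases hε 0 with h0 | h0 <;> rcases hε 1 with h1 | h1
    · exact absurd (h0.trans h1.symm) hne
    · rw [h0, h1]
    · rw [h0, h1, neg_neg]
    · exact absurd (h0.trans h1.symm) hne
  rw [h1]
  exact hbranch 1

/-! ### The codimensions of the jet filtration. -/

/-- Monomials of degree at most one in `y` suffice: `x^k` carries `α k` and `x^(k-n) y` carries `β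
k`. The latter has degree at most `N` because `1 ≤ n`. -/
theorem exists_branchCoeff_eq {n : ℕ} (hn : 1 ≤ n) (N : ℕ) (α β : ℕ → ℂ) :
    ∃ c : JetIndex N → ℂ, ∀ (ε : ℂ), ∀ k ≤ N,
      branchCoeff n N ε k c = α k + if n ≤ k then ε * β k else 0 := by
  refine ⟨fun p => (if (p.1.2 : ℕ) = 0 then α p.1.1 else 0) +
    (if (p.1.2 : ℕ) = 1 then β (p.1.1 + n) else 0), fun ε k hk => ?_⟩
  rw [branchCoeff_apply]
  have hsplit : ∀ p : JetIndex N, (if (p.1.1 : ℕ) + n * p.1.2 = k then ε ^ (p.1.2 : ℕ) *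
      ((if (p.1.2 : ℕ) = 0 then α p.1.1 else 0) + (if (p.1.2 : ℕ) = 1 then β (p.1.1 + n) else 0))
      else 0) = (if (p.1.2 : ℕ) = 0 ∧ (p.1.1 : ℕ) = k then α k else 0) +
      (if (p.1.2 : ℕ) = 1 ∧ (p.1.1 : ℕ) + n = k then ε * β k else 0) := by
    rintro ⟨⟨⟨a, ha⟩, ⟨b, hb⟩⟩, hp⟩
    simp only
    rcases b with _ | _ | b
    · by_cases h : a = k <;> simp [h]
    · by_cases h : a + n = k <;> simp [h]
    · simp
  simp_rw [hsplit]
  rw [Finset.sum_add_distrib]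
  congr 1
  · rw [Finset.sum_eq_single (⟨(⟨k, by omega⟩, ⟨0, by omega⟩), by simpa using hk⟩ : JetIndex N)]
    · simp
    · rintro ⟨⟨⟨a, ha⟩, ⟨b, hb⟩⟩, hp⟩ - hne
      simp at hne ⊢
      omega
    · simp
  · split_ifs with h
    · rw [Finset.sum_eq_single
        (⟨(⟨k - n, by omega⟩, ⟨1, by omega⟩), by simp; omega⟩ : JetIndex N)]
      · simp [h]
      · rintro ⟨⟨⟨a, ha⟩, ⟨b, hb⟩⟩, hp⟩ - hne
        simp at hne ⊢
        omega
      · simp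
    · refine Finset.sum_eq_zero fun p _ => if_neg ?_
      omega

/-- The jets of the functions whose orders along the branches `y = ± ε x ^ n` are at least
`a` and `b`. -/
noncomputable def jetFiltration (n N : ℕ) (ε : ℂ) (a b : ℕ) : Submodule ℂ (JetIndex N → ℂ) where
  carrier := {c | (∀ j < a, branchCoeff n N ε j c = 0) ∧ ∀ j < b, branchCoeff n N (-ε) j c = 0}
  add_mem' := fun h1 h2 =>
    ⟨fun j hj => by rw [map_add, h1.1 j hj, h2.1 j hj, add_zero],
      fun j hj => by rw [map_add, h1.2 j hj, h2.2 j hj, add_zero]⟩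
  zero_mem' := ⟨fun _ _ => map_zero _, fun _ _ => map_zero _⟩
  smul_mem' := fun z _ h =>
    ⟨fun j hj => by rw [map_smul, h.1 j hj, smul_zero],
      fun j hj => by rw [map_smul, h.2 j hj, smul_zero]⟩

theorem mem_jetFiltration {n N : ℕ} {ε : ℂ} {a b : ℕ} {c : JetIndex N → ℂ} :
    c ∈ jetFiltration n N ε a b ↔
      (∀ j < a, branchCoeff n N ε j c = 0) ∧ ∀ j < b, branchCoeff n N (-ε) j c = 0 :=
  Iff.rfl

theorem jetFiltration_swap (n N : ℕ) (ε : ℂ) (a b : ℕ) :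
    jetFiltration n N ε a b = jetFiltration n N (-ε) b a := by
  ext c
  rw [mem_jetFiltration, mem_jetFiltration, neg_neg, and_comm]

/-- The codimension of the set of functions on the plane with orders at least `a` and `b` along
the two branches of an `A_{2n-1}` singularity. -/
def codimA (n a b : ℕ) : ℕ := max a b + (min a b - n)

theorem finrank_quotient_of_surjective {V ι : Type*} [AddCommGroup V] [Module ℂ V] [Fintype ι]
    (Φ : V →ₗ[ℂ] (ι → ℂ)) (hΦ : Function.Surjective Φ) (F : Submodule ℂ V)
    (hF : LinearMap.ker Φ = F) : Module.finrank ℂ (V ⧸ F) = Fintype.card ι := by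
  subst hF
  rw [(Φ.quotKerEquivOfSurjective hΦ).finrank_eq, Module.finrank_fintype_fun_eq_card]

/-- If the smaller bound is at most `n`, its conditions are among those of the other branch. If both
are at least `n`, the second branch adds only the conditions in degrees `n, …, b - 1`. -/
theorem finrank_quotient_jetFiltration {n : ℕ} (hn : 1 ≤ n) {N : ℕ} {ε : ℂ} (hε : ε ^ 2 = 1)
    {a b : ℕ} (ha : a ≤ N + 1) (hb : b ≤ N + 1) :
    Module.finrank ℂ ((JetIndex N → ℂ) ⧸ jetFiltration n N ε a b) = codimA n a b := by
  have hone : ∀ (ε : ℂ) (a b : ℕ), a ≤ n → a ≤ b → b ≤ N + 1 →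
      Module.finrank ℂ ((JetIndex N → ℂ) ⧸ jetFiltration n N ε a b) = b := by
    intro ε a b han hab hb
    rw [finrank_quotient_of_surjective
      (LinearMap.pi fun j : Fin b => branchCoeff n N (-ε) (j : ℕ)), Fintype.card_fin]
    · intro g
      obtain ⟨c, hc⟩ := exists_branchCoeff_eq hn N
        (fun j => if h : j < b then g ⟨j, h⟩ else 0) 0
      refine ⟨c, funext fun j => ?_⟩
      rw [LinearMap.pi_apply, hc _ _ (by omega)]
      simp
    · ext c
      rw [LinearMap.mem_ker, mem_jetFiltration, funext_iff]
      constructor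
      · intro h
        have h2 : ∀ j < b, branchCoeff n N (-ε) j c = 0 := fun j hj => h ⟨j, hj⟩
        refine ⟨fun j hj => ?_, h2⟩
        rw [branchCoeff_eq_of_lt (hj.trans_le han) ε (-ε)]
        exact h2 j (hj.trans_le hab)
      · exact fun h j => h.2 j j.2
  rcases le_total a n with han | han
  · rcases le_total a b with hab | hab
    · rw [hone ε a b han hab hb, codimA]; omega
    · rw [jetFiltration_swap, hone _ b a (hab.trans han) hab ha, codimA]; omega
  rcases le_total b n with hbn | hbn
  · rw [jetFiltration_swap, hone _ b a hbn (hbn.trans han) ha, codimA]; omega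
  rw [finrank_quotient_of_surjective (LinearMap.pi (Sum.elim
      (fun j : Fin a => branchCoeff n N ε (j : ℕ))
      (fun j : Fin (b - n) => branchCoeff n N (-ε) (n + j))))]
  · rw [Fintype.card_sum, Fintype.card_fin, Fintype.card_fin, codimA]; omega
  · intro g
    set g₁ : ℕ → ℂ := fun j => if h : j < a then g (Sum.inl ⟨j, h⟩) else 0 with hg₁
    set g₂ : ℕ → ℂ := fun j => if h : j - n < b - n then g (Sum.inr ⟨j - n, h⟩) else 0 with hg₂
    -- Half-sum and half-difference solve `α + εβ = g₁`, `α - εβ = g₂`; the factor `ε` in `β` works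
    -- since `ε^2 = 1`.
    obtain ⟨c, hc⟩ := exists_branchCoeff_eq hn N
      (fun j => if n ≤ j then (g₁ j + g₂ j) / 2 else g₁ j) (fun j => ε * ((g₁ j - g₂ j) / 2))
    refine ⟨c, funext fun s => ?_⟩
    rw [LinearMap.pi_apply]
    rcases s with j | j
    · have h1 : g (Sum.inl j) = g₁ j := by simp [hg₁]
      rw [Sum.elim_inl, hc _ _ (by omega), h1]
      split_ifs
      · linear_combination ((g₁ j - g₂ j) / 2) * hε
      · simp
    · have h1 : g (Sum.inr j) = g₂ (n + j) := by simp [hg₂]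
      rw [Sum.elim_inr, hc _ _ (by omega), h1]
      simp only [le_add_iff_nonneg_right, zero_le, if_true]
      linear_combination (-(g₁ (n + j) - g₂ (n + j)) / 2) * hε
  · ext c
    rw [LinearMap.mem_ker, mem_jetFiltration, funext_iff]
    constructor
    · intro h
      have h1 : ∀ j < a, branchCoeff n N ε j c = 0 := fun j hj => h (Sum.inl ⟨j, hj⟩)
      refine ⟨h1, fun j hj => ?_⟩
      by_cases hjn : j < n
      · rw [branchCoeff_eq_of_lt hjn (-ε) ε]
        exact h1 j (hjn.trans_le han)
      · have h2 := h (Sum.inr ⟨j - n, by omega⟩)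
        simp only [LinearMap.pi_apply, Sum.elim_inr, Pi.zero_apply] at h2
        rwa [Nat.add_sub_cancel' (by omega)] at h2
    · rintro ⟨h1, h2⟩ (j | j)
      · exact h1 j j.2
      · exact h2 (n + j) (by omega)

/-! ### From jets back to germs. -/

theorem filtration_eq_comap {n : ℕ} {ε : ℂ} {γ : Fin 2 → Arc} (h0 : IsBranchParam n ε (γ 0))
    (h1 : IsBranchParam n (-ε) (γ 1)) {N : ℕ} (v : Fin 2 → ℤ) (hv : ∀ i, (v i).toNat ≤ N + 1) :
    filtration γ v =
      (jetFiltration n N ε (v 0).toNat (v 1).toNat).comap (jetLin N) := by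
  ext g
  have h2 : g ∈ filtration γ v ↔
      ∀ i, ((v i).toNat : ℕ∞) ≤ ordAlong (γ i) (g : Germ (𝓝 (0 : ℂ × ℂ)) ℂ) := Iff.rfl
  rw [h2, Fin.forall_fin_two, natCast_le_ordAlong_iff h0 (hv 0), natCast_le_ordAlong_iff h1 (hv 1)]
  rfl

theorem exists_quotient_filtration_equiv {n : ℕ} {ε : ℂ} {γ : Fin 2 → Arc}
    (h0 : IsBranchParam n ε (γ 0)) (h1 : IsBranchParam n (-ε) (γ 1)) {N : ℕ} (v : Fin 2 → ℤ)
    (hv : ∀ i, (v i).toNat ≤ N + 1) :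
    Nonempty ((HolGerm ⧸ filtration γ v) ≃ₗ[ℂ]
      (JetIndex N → ℂ) ⧸ jetFiltration n N ε (v 0).toNat (v 1).toNat) := by
  set F := jetFiltration n N ε (v 0).toNat (v 1).toNat with hF
  have hker : LinearMap.ker (F.mkQ ∘ₗ jetLin N) = filtration γ v := by
    rw [LinearMap.ker_comp, Submodule.ker_mkQ, filtration_eq_comap h0 h1 v hv]
  rw [← hker]
  exact ⟨(F.mkQ ∘ₗ jetLin N).quotKerEquivOfSurjective
    ((Submodule.mkQ_surjective F).comp (jetLin_surjective N))⟩

theorem finite_quotient_filtration {n : ℕ} {ε : ℂ} {γ : Fin 2 → Arc}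
    (h0 : IsBranchParam n ε (γ 0)) (h1 : IsBranchParam n (-ε) (γ 1)) (v : Fin 2 → ℤ) :
    Module.Finite ℂ (HolGerm ⧸ filtration γ v) := by
  obtain ⟨e⟩ := exists_quotient_filtration_equiv h0 h1 (N := (v 0).toNat + (v 1).toNat) v
    (by rw [Fin.forall_fin_two]; omega)
  exact Module.Finite.equiv e.symm

theorem codim_eq {n : ℕ} (hn : 1 ≤ n) {ε : ℂ} (hε : ε ^ 2 = 1) {γ : Fin 2 → Arc}
    (h0 : IsBranchParam n ε (γ 0)) (h1 : IsBranchParam n (-ε) (γ 1)) (v : Fin 2 → ℤ) :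
    codim γ v = codimA n (v 0).toNat (v 1).toNat := by
  obtain ⟨e⟩ := exists_quotient_filtration_equiv h0 h1 (N := (v 0).toNat + (v 1).toNat) v
    (by rw [Fin.forall_fin_two]; omega)
  rw [codim, e.finrank_eq, finrank_quotient_jetFiltration hn hε (by omega) (by omega)]

/-! ### Projective varieties defined by linear forms, and polynomial isomorphisms. -/

theorem eval_smul_of_isHomogeneous {σ : Type} {p : MvPolynomial σ ℂ} {d : ℕ}
    (hp : p.IsHomogeneous d) (a : ℂ) (v : σ → ℂ) :
    MvPolynomial.eval (a • v) p = a ^ d * MvPolynomial.eval v p := by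
  rw [MvPolynomial.eval_eq, MvPolynomial.eval_eq, Finset.mul_sum]
  refine Finset.sum_congr rfl fun e he => ?_
  have hdeg : ∑ i ∈ e.support, e i = d := by
    have := hp (MvPolynomial.mem_support_iff.1 he)
    simpa [Finsupp.weight_apply, Finsupp.sum] using this
  simp only [Pi.smul_apply, smul_eq_mul, mul_pow, Finset.prod_mul_distrib]
  rw [Finset.prod_pow_eq_pow_sum, hdeg]
  ring

theorem isZariskiClosed_empty {σ : Type} :
    IsZariskiClosed (∅ : Set (Projectivization ℂ (σ → ℂ))) :=
  ⟨{1}, by rintro p rfl; exact ⟨0, MvPolynomial.isHomogeneous_one _ _⟩, by simp⟩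

theorem isZariskiClosed_univ {σ : Type} :
    IsZariskiClosed (Set.univ : Set (Projectivization ℂ (σ → ℂ))) :=
  ⟨∅, by simp, by simp⟩

/-- A linear form as a polynomial. -/
noncomputable def linearPoly {σ : Type} [Fintype σ] (ℓ : (σ → ℂ) →ₗ[ℂ] ℂ) : MvPolynomial σ ℂ :=
  open Classical in ∑ i, MvPolynomial.C (ℓ (Pi.single i 1)) * MvPolynomial.X i

theorem linearPoly_isHomogeneous {σ : Type} [Fintype σ] (ℓ : (σ → ℂ) →ₗ[ℂ] ℂ) :
    (linearPoly ℓ).IsHomogeneous 1 := by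
  classical
  refine MvPolynomial.IsHomogeneous.sum _ _ _ fun i _ => ?_
  simpa using (MvPolynomial.isHomogeneous_C σ _).mul (MvPolynomial.isHomogeneous_X ℂ i)

theorem eval_linearPoly {σ : Type} [Fintype σ] (ℓ : (σ → ℂ) →ₗ[ℂ] ℂ) (v : σ → ℂ) :
    MvPolynomial.eval v (linearPoly ℓ) = ℓ v := by
  classical
  rw [LinearMap.pi_apply_eq_sum_univ ℓ v, linearPoly, map_sum]
  refine Finset.sum_congr rfl fun i _ => ?_
  rw [map_mul, MvPolynomial.eval_C, MvPolynomial.eval_X, smul_eq_mul, mul_comm]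
  congr 2
  funext j
  simp [Pi.single_apply, eq_comm]

theorem isZariskiClosed_submodule {σ : Type} [Fintype σ] (W : Submodule ℂ (σ → ℂ)) :
    IsZariskiClosed {x : Projectivization ℂ (σ → ℂ) | x.rep ∈ W} := by
  refine ⟨linearPoly '' {ℓ : (σ → ℂ) →ₗ[ℂ] ℂ | ℓ ∈ W.dualAnnihilator}, ?_, ?_⟩
  · rintro _ ⟨ℓ, -, rfl⟩
    exact ⟨1, linearPoly_isHomogeneous ℓ⟩
  · ext x
    simp only [Set.mem_ofPred_eq, Set.forall_mem_image, eval_linearPoly]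
    exact (Subspace.forall_mem_dualAnnihilator_apply_eq_zero_iff W x.rep).symm

/-- The points of the projective space of `W` outside the hyperplane `ℓ = 0`. -/
def hyperplaneCompl {σ : Type} (W : Submodule ℂ (σ → ℂ)) (ℓ : (σ → ℂ) →ₗ[ℂ] ℂ) :
    Set (Projectivization ℂ (σ → ℂ)) :=
  {x | x.rep ∈ W ∧ ℓ x.rep ≠ 0}

theorem hyperplaneCompl_locallyClosed {σ : Type} [Fintype σ] (W : Submodule ℂ (σ → ℂ))
    (ℓ : (σ → ℂ) →ₗ[ℂ] ℂ) : IsZariskiLocallyClosed (hyperplaneCompl W ℓ) :=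
  ⟨_, _, isZariskiClosed_submodule W, isZariskiClosed_submodule (LinearMap.ker ℓ), rfl⟩

theorem exists_rep_mk_eq {σ : Type} {v : σ → ℂ} (h : v ≠ 0) :
    ∃ a : ℂ, a ≠ 0 ∧ (Projectivization.mk ℂ v h).rep = a • v := by
  obtain ⟨a, ha⟩ := Projectivization.exists_smul_eq_mk_rep ℂ v h
  exact ⟨a, a.ne_zero, ha.symm⟩

theorem mk_eq_of_eq_smul_rep {σ : Type} {v : σ → ℂ} (h : v ≠ 0)
    {x : Projectivization ℂ (σ → ℂ)} {a : ℂ} (hv : v = a • x.rep) :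
    Projectivization.mk ℂ v h = x := by
  conv_rhs => rw [← x.mk_rep]
  exact (Projectivization.mk_eq_mk_iff' ℂ _ _ _ _).2 ⟨a, hv.symm⟩

theorem isRegularMap_of_polynomial {σ τ : Type} {X : Set (Projectivization ℂ (σ → ℂ))}
    {Y : Set (Projectivization ℂ (τ → ℂ))} (φ : X → Y) {d : ℕ} (F : τ → MvPolynomial σ ℂ)
    (hF : ∀ j, (F j).IsHomogeneous d)
    (h : ∀ z : X, ∃ h : (fun j => MvPolynomial.eval z.1.rep (F j)) ≠ 0,
      (φ z : Projectivization ℂ (τ → ℂ)) = Projectivization.mk ℂ _ h) : IsRegularMap φ :=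
  fun _ => ⟨∅, isZariskiClosed_empty, Set.notMem_empty _, d, F, hF, fun z _ => h z⟩

/-- Two varieties are isomorphic if there are mutually inverse maps between them, each given by
one family of homogeneous polynomials. -/
theorem areIsomorphic_of_polynomial {σ τ : Type} {X : Set (Projectivization ℂ (σ → ℂ))}
    {Y : Set (Projectivization ℂ (τ → ℂ))} {d e : ℕ} (F : τ → MvPolynomial σ ℂ)
    (G : σ → MvPolynomial τ ℂ) (hF : ∀ j, (F j).IsHomogeneous d)
    (hG : ∀ i, (G i).IsHomogeneous e)
    (hXY : ∀ x ∈ X, ∃ h : (fun j => MvPolynomial.eval x.rep (F j)) ≠ 0,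
      Projectivization.mk ℂ _ h ∈ Y)
    (hYX : ∀ y ∈ Y, ∃ h : (fun i => MvPolynomial.eval y.rep (G i)) ≠ 0,
      Projectivization.mk ℂ _ h ∈ X)
    (hGF : ∀ x ∈ X, ∃ c : ℂ, ∀ i,
      MvPolynomial.eval (fun j => MvPolynomial.eval x.rep (F j)) (G i) = c * x.rep i)
    (hFG : ∀ y ∈ Y, ∃ c : ℂ, ∀ j,
      MvPolynomial.eval (fun i => MvPolynomial.eval y.rep (G i)) (F j) = c * y.rep j) :
    AreIsomorphic X Y := by
  choose f hf using hXY
  choose g hg using hYX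
  let eqv : X ≃ Y :=
    { toFun := fun x => ⟨_, hf x.1 x.2⟩
      invFun := fun y => ⟨_, hg y.1 y.2⟩
      left_inv := by
        rintro ⟨x, hx⟩
        obtain ⟨a, -, ha⟩ := exists_rep_mk_eq (f x hx)
        obtain ⟨c, hc⟩ := hGF x hx
        -- The scalar `a` relates the chosen representative of the image to the computed vector;
        -- homogeneity of degree `e` turns it into `a ^ e`.
        refine Subtype.ext (mk_eq_of_eq_smul_rep (a := a ^ e * c) _ ?_)
        funext i
        simp only [ha]
        rw [eval_smul_of_isHomogeneous (hG i), hc i, Pi.smul_apply, smul_eq_mul, mul_assoc]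
      right_inv := by
        rintro ⟨y, hy⟩
        obtain ⟨a, -, ha⟩ := exists_rep_mk_eq (g y hy)
        obtain ⟨c, hc⟩ := hFG y hy
        refine Subtype.ext (mk_eq_of_eq_smul_rep (a := a ^ d * c) _ ?_)
        funext j
        simp only [ha]
        rw [eval_smul_of_isHomogeneous (hF j), hc j, Pi.smul_apply, smul_eq_mul, mul_assoc] }
  exact ⟨eqv, isRegularMap_of_polynomial _ F hF fun z => ⟨f z.1 z.2, rfl⟩,
    isRegularMap_of_polynomial _ G hG fun z => ⟨g z.1 z.2, rfl⟩⟩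

/-! ### Relations in the Grothendieck ring -/

theorem mk_eq_mk_of_rel {a b : FreeVar} (h : GrothendieckRel a b) :
    (Ideal.Quotient.mk (Ideal.ofRel GrothendieckRel) a) = Ideal.Quotient.mk _ b :=
  Ideal.Quotient.eq.2 (Submodule.subset_span ⟨a, b, h, sub_add_cancel a b⟩)

theorem K0.classOf_eq_of_iso {σ τ : Type} [Finite σ] [Finite τ]
    {X : Set (Projectivization ℂ (σ → ℂ))} {Y : Set (Projectivization ℂ (τ → ℂ))}
    (hX : IsZariskiLocallyClosed X) (hY : IsZariskiLocallyClosed Y) (h : AreIsomorphic X Y) :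
    K0.classOf X hX = K0.classOf Y hY :=
  mk_eq_mk_of_rel (.iso X Y hX hY h)

theorem K0.classOf_scissor {σ : Type} [Finite σ] {X Z : Set (Projectivization ℂ (σ → ℂ))}
    (hX : IsZariskiLocallyClosed X) (hZ : IsZariskiClosed Z)
    (hXZ : IsZariskiLocallyClosed (X ∩ Z)) (hXZ' : IsZariskiLocallyClosed (X \ Z)) :
    K0.classOf X hX = K0.classOf (X ∩ Z) hXZ + K0.classOf (X \ Z) hXZ' :=
  (mk_eq_mk_of_rel (.scissor X Z hX hZ hXZ hXZ')).trans (map_add _ _ _)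

theorem K0.classOf_segreProduct {σ τ : Type} [Finite σ] [Finite τ]
    {X : Set (Projectivization ℂ (σ → ℂ))} {Y : Set (Projectivization ℂ (τ → ℂ))}
    (hX : IsZariskiLocallyClosed X) (hY : IsZariskiLocallyClosed Y)
    (hXY : IsZariskiLocallyClosed (segreProduct X Y)) :
    K0.classOf (segreProduct X Y) hXY = K0.classOf X hX * K0.classOf Y hY :=
  (mk_eq_mk_of_rel (.prod X Y hX hY hXY)).symm.trans (map_mul _ _ _)

theorem K0.classOf_singleton {σ : Type} [Finite σ] (x : Projectivization ℂ (σ → ℂ))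
    (hx : IsZariskiLocallyClosed {x}) : K0.classOf {x} hx = 1 :=
  (mk_eq_mk_of_rel (.point x hx)).trans (map_one _)

theorem K0.classOf_congr {σ : Type} [Finite σ] {X Y : Set (Projectivization ℂ (σ → ℂ))}
    (h : X = Y) (hX : IsZariskiLocallyClosed X) :
    K0.classOf X hX = K0.classOf Y (h ▸ hX) := by
  subst h; rfl

/-- Cutting `∅` along `∅` gives `[∅] = [∅] + [∅]`. -/
theorem K0.classOf_empty {σ : Type} [Finite σ]
    (h : IsZariskiLocallyClosed (∅ : Set (Projectivization ℂ (σ → ℂ)))) :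
    K0.classOf ∅ h = 0 := by
  have h1 := K0.classOf_scissor (X := ∅) (Z := (∅ : Set (Projectivization ℂ (σ → ℂ)))) h
    isZariskiClosed_empty (by simpa using h) (by simpa using h)
  rw [K0.classOf_congr (Set.inter_empty (∅ : Set (Projectivization ℂ (σ → ℂ)))),
    K0.classOf_congr (Set.sdiff_empty (s := (∅ : Set (Projectivization ℂ (σ → ℂ)))))] at h1
  simpa using h1

/-! ### Affine spaces -/

/-- The standard affine chart of a projective space. -/
def affineChart {σ : Type} (i : σ) : Set (Projectivization ℂ (σ → ℂ)) := {x | x.rep i ≠ 0}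

theorem affineChart_locallyClosed {σ : Type} (i : σ) : IsZariskiLocallyClosed (affineChart i) := by
  refine ⟨Set.univ, {x | x.rep i = 0}, isZariskiClosed_univ, ⟨{MvPolynomial.X i}, ?_, by simp⟩, ?_⟩
  · rintro p rfl
    exact ⟨1, MvPolynomial.isHomogeneous_X ℂ i⟩
  · ext x
    simp [affineChart]

/-- Replaces chosen representatives by arbitrary ones: the points are the rank one matrices with
nonzero entry `(i₀, 0)`. -/
theorem mem_segreProduct_affineChart {σ : Type} (i₀ : σ)
    (z : Projectivization ℂ (σ × Fin 2 → ℂ)) :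
    z ∈ segreProduct (affineChart i₀) affineLine ↔
      ∃ (u : σ → ℂ) (w : Fin 2 → ℂ), u i₀ ≠ 0 ∧ w 0 ≠ 0 ∧ ∀ i j, z.rep (i, j) = u i * w j := by
  constructor
  · rintro ⟨x, hx, y, hy, h, rfl⟩
    obtain ⟨a, ha0, ha⟩ := exists_rep_mk_eq h
    refine ⟨a • x.rep, y.rep, mul_ne_zero ha0 hx, hy, fun i j => ?_⟩
    rw [ha]
    simp [mul_assoc]
  · rintro ⟨u, w, hu, hw, hz⟩
    have hu0 : u ≠ 0 := fun h => hu (by rw [h]; rfl)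
    have hw0 : w ≠ 0 := fun h => hw (by rw [h]; rfl)
    obtain ⟨a, ha0, ha⟩ := exists_rep_mk_eq hu0
    obtain ⟨b, hb0, hb⟩ := exists_rep_mk_eq hw0
    refine ⟨Projectivization.mk ℂ u hu0, ?_, Projectivization.mk ℂ w hw0, ?_, ?_, ?_⟩
    · simp only [affineChart, Set.mem_ofPred_eq, ha]
      exact mul_ne_zero ha0 hu
    · simp only [affineLine, Set.mem_ofPred_eq, hb]
      exact mul_ne_zero hb0 hw
    · intro h
      have := congrFun h (i₀, 0)
      simp only [ha, hb, Pi.smul_apply, smul_eq_mul, Pi.zero_apply] at this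
      exact mul_ne_zero (mul_ne_zero ha0 hu) (mul_ne_zero hb0 hw) this
    · refine (mk_eq_of_eq_smul_rep (a := a * b) _ ?_).symm
      funext ⟨i, j⟩
      simp only [ha, hb, Pi.smul_apply, smul_eq_mul, hz]
      ring

theorem segreProduct_affineChart_locallyClosed {σ : Type} (i₀ : σ) :
    IsZariskiLocallyClosed (segreProduct (affineChart i₀) affineLine) := by
  refine ⟨{z | ∀ (i k : σ) (j l : Fin 2), z.rep (i, j) * z.rep (k, l) =
    z.rep (i, l) * z.rep (k, j)}, {z | z.rep (i₀, 0) = 0}, ?_, ?_, ?_⟩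
  · refine ⟨{p | ∃ (i k : σ) (j l : Fin 2), p = MvPolynomial.X (i, j) * MvPolynomial.X (k, l) -
      MvPolynomial.X (i, l) * MvPolynomial.X (k, j)}, ?_, ?_⟩
    · rintro _ ⟨i, k, j, l, rfl⟩
      exact ⟨2, ((MvPolynomial.isHomogeneous_X ℂ _).mul (MvPolynomial.isHomogeneous_X ℂ _)).sub
        ((MvPolynomial.isHomogeneous_X ℂ _).mul (MvPolynomial.isHomogeneous_X ℂ _))⟩
    · ext z
      constructor
      · rintro h _ ⟨i, k, j, l, rfl⟩
        simpa [sub_eq_zero] using h i k j l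
      · intro h i k j l
        simpa [sub_eq_zero] using h _ ⟨i, k, j, l, rfl⟩
  · refine ⟨{MvPolynomial.X (i₀, 0)}, ?_, by simp⟩
    rintro p rfl
    exact ⟨1, MvPolynomial.isHomogeneous_X ℂ _⟩
  · ext z
    rw [mem_segreProduct_affineChart]
    constructor
    · rintro ⟨u, w, hu, hw, h⟩
      refine ⟨fun i k j l => ?_, fun h0 => ?_⟩
      · rw [h, h, h, h]; ring
      · have h1 : z.rep (i₀, 0) = 0 := h0
        rw [h] at h1
        exact mul_ne_zero hu hw h1
    · rintro ⟨h1, h2⟩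
      have h2' : z.rep (i₀, 0) ≠ 0 := h2
      -- With vanishing 2 × 2 minors, the matrix is its column `0` times its row `i₀` normalised at
      -- `(i₀, 0)`.
      refine ⟨fun i => z.rep (i, 0), fun j => z.rep (i₀, j) / z.rep (i₀, 0), h2', ?_, fun i j => ?_⟩
      · simp only [div_self h2']
        exact one_ne_zero
      · have := h1 i i₀ j 0
        field_simp
        exact this

/-- This is `𝔸^(d+1) ≅ 𝔸^d × 𝔸^1`, the coordinate `none` being split off. The composites multiply by
the nonzero scalars `x_{i₀}` and `z_{(i₀, 0)}`. -/
theorem affineChart_option_iso {σ : Type} (i₀ : σ) :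
    AreIsomorphic (affineChart (some i₀)) (segreProduct (affineChart i₀) affineLine) := by
  let F : σ × Fin 2 → MvPolynomial (Option σ) ℂ := fun p =>
    MvPolynomial.X (some p.1) * (if p.2 = 0 then MvPolynomial.X (some i₀) else MvPolynomial.X none)
  let G : Option σ → MvPolynomial (σ × Fin 2) ℂ := fun o =>
    o.elim (MvPolynomial.X (i₀, 1)) (fun i => MvPolynomial.X (i, 0))
  have hF : ∀ (v : Option σ → ℂ) (p : σ × Fin 2), MvPolynomial.eval v (F p) =
      v (some p.1) * (if p.2 = 0 then v (some i₀) else v none) := by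
    intro v p
    simp only [F, map_mul, MvPolynomial.eval_X]
    split_ifs <;> simp
  have hG : ∀ (w : σ × Fin 2 → ℂ) (o : Option σ), MvPolynomial.eval w (G o) =
      o.elim (w (i₀, 1)) (fun i => w (i, 0)) := by
    intro w o
    rcases o with _ | i <;> simp [G]
  refine areIsomorphic_of_polynomial (d := 2) (e := 1) F G ?_ ?_ ?_ ?_ ?_ ?_
  · rintro ⟨i, j⟩
    refine (MvPolynomial.isHomogeneous_X ℂ _).mul (n := 1) ?_
    split_ifs <;> exact MvPolynomial.isHomogeneous_X ℂ _
  · rintro (_ | i) <;> exact MvPolynomial.isHomogeneous_X ℂ _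
  · intro x hx
    have hx' : x.rep (some i₀) ≠ 0 := hx
    have h0 : (fun p => MvPolynomial.eval x.rep (F p)) ≠ 0 := by
      intro h
      have := congrFun h (i₀, 0)
      simp only [hF, if_true, Pi.zero_apply] at this
      exact mul_ne_zero hx' hx' this
    obtain ⟨a, ha0, ha⟩ := exists_rep_mk_eq h0
    refine ⟨h0, (mem_segreProduct_affineChart _ _).2 ⟨fun i => a * x.rep (some i),
      fun j => if j = 0 then x.rep (some i₀) else x.rep none, mul_ne_zero ha0 hx', by simpa using hx',
      fun i j => ?_⟩⟩
    rw [ha, Pi.smul_apply, hF, smul_eq_mul, mul_assoc]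
  · intro z hz
    obtain ⟨u, w, hu, hw, h⟩ := (mem_segreProduct_affineChart _ _).1 hz
    have h0 : (fun o => MvPolynomial.eval z.rep (G o)) ≠ 0 := by
      intro h0
      have := congrFun h0 (some i₀)
      simp only [hG, Option.elim, Pi.zero_apply, h] at this
      exact mul_ne_zero hu hw this
    obtain ⟨a, ha0, ha⟩ := exists_rep_mk_eq h0
    refine ⟨h0, ?_⟩
    have h1 : (Projectivization.mk ℂ _ h0).rep (some i₀) = a * (u i₀ * w 0) := by
      rw [ha, Pi.smul_apply, hG, Option.elim, h, smul_eq_mul]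
    exact h1.trans_ne (mul_ne_zero ha0 (mul_ne_zero hu hw))
  · intro x hx
    refine ⟨x.rep (some i₀), ?_⟩
    rintro (_ | i)
    · simp [hG, hF]
    · simp [hG, hF, mul_comm]
  · intro z hz
    obtain ⟨u, w, hu, hw, h⟩ := (mem_segreProduct_affineChart _ _).1 hz
    refine ⟨u i₀ * w 0, ?_⟩
    rintro ⟨i, j⟩
    fin_cases j
    · simp [hG, hF, h]; ring
    · simp [hG, hF, h]; ring

theorem exists_affineChart_class (d : ℕ) : ∃ (σ : Type) (_ : Fintype σ) (i₀ : σ),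
    Fintype.card σ = d + 1 ∧
      K0.classOf (affineChart i₀) (affineChart_locallyClosed i₀) = lefschetz ^ d := by
  induction d with
  | zero =>
    refine ⟨Unit, inferInstance, (), by simp, ?_⟩
    have h1 : (fun _ : Unit => (1 : ℂ)) ≠ 0 := fun h => one_ne_zero (congrFun h ())
    have h2 : affineChart () = {Projectivization.mk ℂ (fun _ : Unit => (1 : ℂ)) h1} := by
      ext x
      have hx : x.rep () ≠ 0 := fun h => x.rep_nonzero (funext fun _ => h)
      have h3 : x.rep () • (fun _ : Unit => (1 : ℂ)) = x.rep := by funext; simp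
      have h4 : x = Projectivization.mk ℂ (fun _ : Unit => (1 : ℂ)) h1 := by
        refine (mk_eq_of_eq_smul_rep (a := (x.rep ())⁻¹) h1 ?_).symm
        funext i
        simp [hx]
      simp only [Set.mem_singleton_iff, h4, iff_true]
      rw [← h4]
      exact hx
    rw [K0.classOf_congr h2, K0.classOf_singleton, pow_zero]
  | succ d ih =>
    obtain ⟨σ, hσ, i₀, hcard, hcl⟩ := ih
    refine ⟨Option σ, inferInstance, some i₀, by simp [hcard], ?_⟩
    rw [K0.classOf_eq_of_iso _ (segreProduct_affineChart_locallyClosed i₀)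
      (affineChart_option_iso i₀), K0.classOf_segreProduct (affineChart_locallyClosed i₀)
      affineLine_locallyClosed, hcl, pow_succ]
    rfl

/-! ### Classes of hyperplane complements. -/

/-- Coordinates adapted to `ℓ`: `ℓ` itself, then coordinates of `ker ℓ` composed with a projection
onto it. -/
theorem exists_equiv_fun {W τ : Type} [AddCommGroup W] [Module ℂ W] [FiniteDimensional ℂ W]
    [Fintype τ] (i₀ : τ) (hW : Module.finrank ℂ W = Fintype.card τ) (ℓ : W →ₗ[ℂ] ℂ) (hℓ : ℓ ≠ 0) :
    ∃ e : W ≃ₗ[ℂ] (τ → ℂ), ∀ w, e w i₀ = ℓ w := by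
  classical
  have hker : Module.finrank ℂ (LinearMap.ker ℓ) = Module.finrank ℂ ({j // j ≠ i₀} → ℂ) := by
    have h1 := Module.Dual.finrank_ker_add_one_of_ne_zero (f := ℓ) hℓ
    have h2 : Fintype.card {j // j ≠ i₀} = Fintype.card τ - 1 := by
      simp [Fintype.card_subtype_compl]
    rw [Module.finrank_fintype_fun_eq_card, h2]
    omega
  let κ := LinearEquiv.ofFinrankEq _ _ hker
  obtain ⟨π, hπ⟩ := (LinearMap.ker ℓ).subtype.exists_leftInverse_of_injective
    (Submodule.ker_subtype _)
  let Ψ : W →ₗ[ℂ] (τ → ℂ) := LinearMap.pi fun j =>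
    if h : j = i₀ then ℓ else (LinearMap.proj (⟨j, h⟩ : {j // j ≠ i₀})) ∘ₗ κ.toLinearMap ∘ₗ π
  have hΨ0 : ∀ w, Ψ w i₀ = ℓ w := fun w => by simp [Ψ]
  have hinj : Function.Injective Ψ := by
    rw [← LinearMap.ker_eq_bot, LinearMap.ker_eq_bot']
    intro w hw
    have h0 : ℓ w = 0 := by rw [← hΨ0, hw]; rfl
    have h1 : π w = ⟨w, h0⟩ := LinearMap.congr_fun hπ ⟨w, h0⟩
    have h2 : κ (π w) = 0 := by
      funext j
      have := congrFun hw j.1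
      simpa [Ψ, j.2] using this
    rw [LinearEquiv.map_eq_zero_iff, h1] at h2
    exact congrArg Subtype.val h2
  refine ⟨Ψ.linearEquivOfInjective hinj ?_, fun w => ?_⟩
  · rw [hW, Module.finrank_fintype_fun_eq_card]
  · rw [LinearMap.linearEquivOfInjective_apply, hΨ0]

/-- Adapted coordinates identify the set with a standard chart. A linear retraction `π` onto `W`
extends them to linear forms on the whole ambient space. -/
theorem classOf_hyperplaneCompl {σ : Type} [Fintype σ] (W : Submodule ℂ (σ → ℂ))
    (ℓ : (σ → ℂ) →ₗ[ℂ] ℂ) {d : ℕ} (hW : Module.finrank ℂ W = d + 1)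
    (hℓ : ∃ w ∈ W, ℓ w ≠ 0) :
    K0.classOf (hyperplaneCompl W ℓ) (hyperplaneCompl_locallyClosed W ℓ) = lefschetz ^ d := by
  obtain ⟨τ, hτ, i₀, hcard, hcl⟩ := exists_affineChart_class d
  rw [← hcl]
  refine K0.classOf_eq_of_iso _ _ ?_
  obtain ⟨e, he⟩ := exists_equiv_fun i₀ (hW.trans hcard.symm) (ℓ ∘ₗ W.subtype) (by
    obtain ⟨w, hw, hne⟩ := hℓ
    exact fun h => hne (LinearMap.congr_fun h ⟨w, hw⟩))
  obtain ⟨π, hπ⟩ := W.subtype.exists_leftInverse_of_injective (Submodule.ker_subtype _)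
  have hπ' : ∀ w (hw : w ∈ W), π w = ⟨w, hw⟩ := fun w hw => LinearMap.congr_fun hπ ⟨w, hw⟩
  let F : τ → MvPolynomial σ ℂ := fun j => linearPoly (LinearMap.proj j ∘ₗ e.toLinearMap ∘ₗ π)
  let G : σ → MvPolynomial τ ℂ := fun i =>
    linearPoly (LinearMap.proj i ∘ₗ W.subtype ∘ₗ e.symm.toLinearMap)
  have hF : ∀ v, (fun j => MvPolynomial.eval v (F j)) = e (π v) := by
    intro v; funext j; simp [F, eval_linearPoly]
  have hG : ∀ v, (fun i => MvPolynomial.eval v (G i)) = (e.symm v : σ → ℂ) := by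
    intro v; funext j; simp [G, eval_linearPoly]
  have heπ : ∀ w ∈ W, e (π w) i₀ = ℓ w := by
    intro w hw; rw [he, hπ' w hw]; rfl
  have hℓe : ∀ v, ℓ (e.symm v : σ → ℂ) = v i₀ := by
    intro v
    have := he (e.symm v)
    rw [e.apply_symm_apply] at this
    exact this.symm
  refine areIsomorphic_of_polynomial (d := 1) (e := 1) F G
    (fun j => linearPoly_isHomogeneous _) (fun i => linearPoly_isHomogeneous _) ?_ ?_ ?_ ?_
  · rintro x ⟨hxW, hxℓ⟩
    have h0 : e (π x.rep) i₀ ≠ 0 := by rwa [heπ _ hxW]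
    have h1 : (fun j => MvPolynomial.eval x.rep (F j)) ≠ 0 := by
      rw [hF]; exact fun h => h0 (congrFun h i₀)
    obtain ⟨a, ha0, ha⟩ := exists_rep_mk_eq h1
    refine ⟨h1, ?_⟩
    simp only [affineChart, Set.mem_ofPred_eq, ha]
    rw [hF]
    exact mul_ne_zero ha0 h0
  · intro y hy
    have hy' : y.rep i₀ ≠ 0 := hy
    have h0 : ℓ (e.symm y.rep : σ → ℂ) ≠ 0 := by rwa [hℓe]
    have h1 : (fun i => MvPolynomial.eval y.rep (G i)) ≠ 0 := by
      rw [hG]; exact fun h => h0 (by rw [h, map_zero])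
    obtain ⟨a, ha0, ha⟩ := exists_rep_mk_eq h1
    refine ⟨h1, ?_⟩
    simp only [hyperplaneCompl, Set.mem_ofPred_eq, ha]
    rw [hG, map_smul]
    exact ⟨W.smul_mem a (e.symm y.rep).2, mul_ne_zero ha0 h0⟩
  · rintro x ⟨hxW, -⟩
    refine ⟨1, fun i => ?_⟩
    have := congrFun (hG (e (π x.rep))) i
    rw [hF, this, e.symm_apply_apply, hπ' _ hxW, one_mul]
  · intro y hy
    refine ⟨1, fun j => ?_⟩
    have := congrFun (hF (e.symm y.rep : σ → ℂ)) j
    rw [hG, this, hπ' _ (e.symm y.rep).2, one_mul]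
    simp

/-- From the affine space `ℓ ≠ 0` in `ℙ(W)`, the scissor relation removes the part `ℓ' = 0`, an
affine space of one dimension less. -/
theorem classOf_hyperplaneCompl_diff {σ : Type} [Fintype σ] (W : Submodule ℂ (σ → ℂ))
    (ℓ ℓ' : (σ → ℂ) →ₗ[ℂ] ℂ) {d : ℕ} (hW : Module.finrank ℂ W = d + 2)
    (hW' : Module.finrank ℂ (W ⊓ LinearMap.ker ℓ' : Submodule ℂ (σ → ℂ)) = d + 1)
    (hℓ : ∃ w ∈ W, ℓ' w = 0 ∧ ℓ w ≠ 0)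
    (h : IsZariskiLocallyClosed {x : Projectivization ℂ (σ → ℂ) |
      x.rep ∈ W ∧ ℓ x.rep ≠ 0 ∧ ℓ' x.rep ≠ 0}) :
    K0.classOf _ h = lefschetz ^ (d + 1) - lefschetz ^ d := by
  have hZ := isZariskiClosed_submodule (LinearMap.ker ℓ')
  have h1 : hyperplaneCompl W ℓ ∩ {x | x.rep ∈ LinearMap.ker ℓ'} =
      hyperplaneCompl (W ⊓ LinearMap.ker ℓ') ℓ := by
    ext x
    simp only [hyperplaneCompl, Set.mem_inter_iff, Set.mem_ofPred_eq, Submodule.mem_inf]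
    tauto
  have h2 : hyperplaneCompl W ℓ \ {x | x.rep ∈ LinearMap.ker ℓ'} =
      {x : Projectivization ℂ (σ → ℂ) | x.rep ∈ W ∧ ℓ x.rep ≠ 0 ∧ ℓ' x.rep ≠ 0} := by
    ext x
    simp only [hyperplaneCompl, Set.mem_sdiff, Set.mem_ofPred_eq, LinearMap.mem_ker]
    tauto
  obtain ⟨w, hw, hw', hne⟩ := hℓ
  have h3 := K0.classOf_scissor (hyperplaneCompl_locallyClosed W ℓ) hZ
    (h1 ▸ hyperplaneCompl_locallyClosed _ _) (h2 ▸ h)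
  rw [K0.classOf_congr h1, K0.classOf_congr h2, classOf_hyperplaneCompl W ℓ hW ⟨w, hw, hne⟩,
    classOf_hyperplaneCompl (W ⊓ LinearMap.ker ℓ') ℓ hW' ⟨w, ⟨hw, hw'⟩, hne⟩] at h3
  rw [h3]
  ring

theorem locallyClosed_two_forms {σ : Type} [Fintype σ] (W : Submodule ℂ (σ → ℂ))
    (ℓ ℓ' : (σ → ℂ) →ₗ[ℂ] ℂ) : IsZariskiLocallyClosed
      {x : Projectivization ℂ (σ → ℂ) | x.rep ∈ W ∧ ℓ x.rep ≠ 0 ∧ ℓ' x.rep ≠ 0} := by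
  refine ⟨_, {x | ℓ x.rep * ℓ' x.rep = 0}, isZariskiClosed_submodule W,
    ⟨{linearPoly ℓ * linearPoly ℓ'}, ?_, ?_⟩, ?_⟩
  · rintro _ rfl
    exact ⟨2, (linearPoly_isHomogeneous ℓ).mul (linearPoly_isHomogeneous ℓ')⟩
  · ext x
    simp [eval_linearPoly]
  · ext x
    simp only [Set.mem_sdiff, Set.mem_ofPred_eq, mul_eq_zero, not_or]

/-! ### The motivic measure of the level sets. -/

theorem finrank_jetFiltration_add {n : ℕ} (hn : 1 ≤ n) {N : ℕ} {ε : ℂ} (hε : ε ^ 2 = 1)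
    {a b : ℕ} (ha : a ≤ N + 1) (hb : b ≤ N + 1) :
    codimA n a b + Module.finrank ℂ (jetFiltration n N ε a b) = (N + 1) * (N + 2) / 2 := by
  rw [← finrank_quotient_jetFiltration hn hε ha hb, Submodule.finrank_quotient_add_finrank,
    Module.finrank_fintype_fun_eq_card, card_jetIndex]

/-- The projective classes of jets whose orders along the branches `y = ± ε x ^ n` are exactly
`a` and `b`. -/
def jetLevelSet (n N : ℕ) (ε : ℂ) (a b : ℕ) : Set (Projectivization ℂ (JetIndex N → ℂ)) :=
  {y | y.rep ∈ jetFiltration n N ε a b ∧ branchCoeff n N ε a y.rep ≠ 0 ∧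
    branchCoeff n N (-ε) b y.rep ≠ 0}

theorem ordAlong_eq_iff {n : ℕ} {ε : ℂ} {γ : Arc} (hγ : IsBranchParam n ε γ) {N v : ℕ}
    (hv : v ≤ N) (g : HolGerm) :
    ordAlong γ (g : Germ (𝓝 (0 : ℂ × ℂ)) ℂ) = (v : ℕ∞) ↔
      (∀ j < v, branchCoeff n N ε j (jet N g) = 0) ∧ branchCoeff n N ε v (jet N g) ≠ 0 := by
  have h1 := natCast_le_ordAlong_iff hγ (N := N) (v := v) (by omega) g
  have h2 := natCast_le_ordAlong_iff hγ (N := N) (v := v + 1) (by omega) g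
  rw [Nat.forall_lt_succ_right, ← h1] at h2
  rw [← h1]
  push_cast at h2
  rw [ENat.add_one_le_iff (ENat.natCast_ne_top v)] at h2
  constructor
  · intro h
    refine ⟨h.ge, fun h3 => ?_⟩
    exact (h2.2 ⟨h.ge, h3⟩).ne h.symm
  · rintro ⟨h3, h4⟩
    refine le_antisymm (not_lt.1 fun h5 => h4 (h2.1 h5).2) h3

theorem levelSet_eq_cylinder {n : ℕ} {ε : ℂ} {γ : Fin 2 → Arc} (h0 : IsBranchParam n ε (γ 0))
    (h1 : IsBranchParam n (-ε) (γ 1)) {N : ℕ} (v : Fin 2 →₀ ℕ) (hv : ∀ i, v i ≤ N) :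
    levelSet γ v = cylinder N (jetLevelSet n N ε (v 0) (v 1)) := by
  ext x
  have h2 : x ∈ levelSet γ v ↔ jet N x.rep ∈ jetFiltration n N ε (v 0) (v 1) ∧
      branchCoeff n N ε (v 0) (jet N x.rep) ≠ 0 ∧
      branchCoeff n N (-ε) (v 1) (jet N x.rep) ≠ 0 := by
    simp only [levelSet, Set.mem_ofPred_eq]
    rw [Fin.forall_fin_two, ordAlong_eq_iff h0 (hv 0), ordAlong_eq_iff h1 (hv 1),
      mem_jetFiltration]
    tauto
  rw [h2]
  have h3 : ∀ h : jet N x.rep ≠ 0,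
      Projectivization.mk ℂ (jet N x.rep) h ∈ jetLevelSet n N ε (v 0) (v 1) ↔
      jet N x.rep ∈ jetFiltration n N ε (v 0) (v 1) ∧
      branchCoeff n N ε (v 0) (jet N x.rep) ≠ 0 ∧
      branchCoeff n N (-ε) (v 1) (jet N x.rep) ≠ 0 := by
    intro h
    obtain ⟨a, ha0, ha⟩ := exists_rep_mk_eq h
    simp only [jetLevelSet, Set.mem_ofPred_eq, ha, map_smul, smul_eq_mul, ne_eq, mul_eq_zero, ha0,
      false_or, Submodule.smul_mem_iff _ ha0]
  constructor
  · intro h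
    -- A nonvanishing coefficient keeps the germ in the domain of the partial map to jets.
    have hne : jet N x.rep ≠ 0 := fun h4 => h.2.1 (by rw [h4, map_zero])
    exact ⟨hne, (h3 hne).2 h⟩
  · rintro ⟨hne, h⟩
    exact (h3 hne).1 h

/-- Turns a drop of dimension in the filtration into a vector off the hyperplane. -/
theorem exists_ne_zero_of_finrank_lt {V : Type*} [AddCommGroup V] [Module ℂ V]
    [FiniteDimensional ℂ V] {W W' : Submodule ℂ V} (ℓ : V →ₗ[ℂ] ℂ)
    (h : ∀ w ∈ W, ℓ w = 0 → w ∈ W') (hlt : Module.finrank ℂ W' < Module.finrank ℂ W) :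
    ∃ w ∈ W, ℓ w ≠ 0 := by
  by_contra! hcon
  exact absurd (Submodule.finrank_mono fun w hw => h w hw (hcon w hw)) (not_le.2 hlt)

theorem algebraMap_lefschetz_pow_mul (d r : ℕ) :
    algebraMap K0 K0Loc (lefschetz ^ d) * qMot ^ (d + r) = qMot ^ r := by
  have h : algebraMap K0 K0Loc lefschetz * qMot = 1 := IsLocalization.Away.mul_invSelf lefschetz
  rw [map_pow, pow_add, ← mul_assoc, ← mul_pow, h, one_pow, one_mul]

/-- The coefficients of `seriesA`. -/
def coeffA {R : Type*} [CommRing R] (q : R) (n a b : ℕ) : R :=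
  if n ≤ a ∧ n ≤ b then q ^ (a + b - n) * (1 - q) else if a = b then q ^ a else 0

theorem hasMeasure_levelSet {n : ℕ} (hn : 1 ≤ n) {ε : ℂ} (hε : ε ^ 2 = 1) {γ : Fin 2 → Arc}
    (h0 : IsBranchParam n ε (γ 0)) (h1 : IsBranchParam n (-ε) (γ 1)) (v : Fin 2 →₀ ℕ) :
    HasMeasure (levelSet γ v) (coeffA qMot n (v 0) (v 1)) := by
  set N := max (v 0) (v 1) with hN
  have hv0 : v 0 ≤ N := le_max_left _ _
  have hv1 : v 1 ≤ N := le_max_right _ _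
  have hcyl := levelSet_eq_cylinder h0 h1 (N := N) v (Fin.forall_fin_two.2 ⟨hv0, hv1⟩)
  have hlc := locallyClosed_two_forms (jetFiltration n N ε (v 0) (v 1))
    (branchCoeff n N ε (v 0)) (branchCoeff n N (-ε) (v 1))
  have hrank := fun a b => @finrank_jetFiltration_add n hn N ε hε a b
  suffices hm : algebraMap K0 K0Loc (K0.classOf _ hlc) * qMot ^ ((N + 1) * (N + 2) / 2 - 1) =
      coeffA qMot n (v 0) (v 1) from ⟨N, _, _, HasClass.locallyClosed _ hlc, hcyl, hm.symm⟩
  unfold coeffA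
  split_ifs with hge heq
  -- Both orders at least `n`: the dimension drops by one with each raised index, so the class is
  -- `𝕃^(d+1) - 𝕃^d`.
  · have r1 := hrank (v 0) (v 1) (by omega) (by omega)
    have r2 := hrank (v 0) (v 1 + 1) (by omega) (by omega)
    have r3 := hrank (v 0 + 1) (v 1 + 1) (by omega) (by omega)
    simp only [codimA] at r1 r2 r3
    set d := Module.finrank ℂ (jetFiltration n N ε (v 0 + 1) (v 1 + 1)) with hd
    have hinf : jetFiltration n N ε (v 0) (v 1) ⊓ LinearMap.ker (branchCoeff n N (-ε) (v 1)) =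
        jetFiltration n N ε (v 0) (v 1 + 1) := by
      ext c
      rw [Submodule.mem_inf, mem_jetFiltration, mem_jetFiltration, LinearMap.mem_ker,
        Nat.forall_lt_succ_right, and_assoc]
    rw [classOf_hyperplaneCompl_diff (d := d) _ _ _ (by omega) (by rw [hinf]; omega) ?_]
    · have h4 : (N + 1) * (N + 2) / 2 - 1 = d + 1 + (v 0 + v 1 - n) := by omega
      rw [map_sub, sub_mul, h4, algebraMap_lefschetz_pow_mul, add_assoc,
        algebraMap_lefschetz_pow_mul]
      ring
    · obtain ⟨w, hw, hne⟩ := exists_ne_zero_of_finrank_lt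
        (W := jetFiltration n N ε (v 0) (v 1 + 1)) (W' := jetFiltration n N ε (v 0 + 1) (v 1 + 1))
        (branchCoeff n N ε (v 0)) (fun w hw h => by
          rw [mem_jetFiltration] at hw ⊢
          rw [Nat.forall_lt_succ_right]
          exact ⟨⟨hw.1, h⟩, hw.2⟩) (by omega)
      rw [← hinf] at hw
      exact ⟨w, hw.1, hw.2, hne⟩
  -- Equal orders below `n`: the two forms coincide, leaving one hyperplane complement of dimension
  -- `d`.
  · have hlt : v 0 < n := by omega
    have r1 := hrank (v 0) (v 1) (by omega) (by omega)
    have r3 := hrank (v 0 + 1) (v 1 + 1) (by omega) (by omega)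
    simp only [codimA] at r1 r3
    set d := Module.finrank ℂ (jetFiltration n N ε (v 0 + 1) (v 1 + 1)) with hd
    have hcoeff : branchCoeff n N (-ε) (v 1) = branchCoeff n N ε (v 0) := by
      rw [← heq]; exact branchCoeff_eq_of_lt hlt _ _
    rw [K0.classOf_congr (Y := hyperplaneCompl (jetFiltration n N ε (v 0) (v 1))
      (branchCoeff n N ε (v 0))) (by rw [hcoeff]; ext x; simp [hyperplaneCompl]),
      classOf_hyperplaneCompl (d := d) _ _ (by omega) ?_]
    · have h4 : (N + 1) * (N + 2) / 2 - 1 = d + v 0 := by omega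
      rw [h4, algebraMap_lefschetz_pow_mul]
    · refine exists_ne_zero_of_finrank_lt
        (W' := jetFiltration n N ε (v 0 + 1) (v 1 + 1)) _ (fun w hw h => ?_) (by omega)
      rw [mem_jetFiltration] at hw ⊢
      rw [Nat.forall_lt_succ_right, Nat.forall_lt_succ_right]
      exact ⟨⟨hw.1, h⟩, hw.2, by rw [hcoeff]; exact h⟩
  -- Unequal orders, the smaller below `n`: its leading coefficient is also one on the other branch,
  -- where it vanishes.
  · rw [K0.classOf_congr (Y := ∅), K0.classOf_empty, map_zero, zero_mul]
    rw [Set.eq_empty_iff_forall_notMem]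
    rintro x ⟨hx, hne0, hne1⟩
    rw [mem_jetFiltration] at hx
    rcases lt_or_gt_of_ne heq with h | h
    · refine hne0 ?_
      rw [branchCoeff_eq_of_lt (by omega) ε (-ε)]
      exact hx.2 _ h
    · refine hne1 ?_
      rw [branchCoeff_eq_of_lt (by omega) (-ε) ε]
      exact hx.1 _ h

/-! ### The coefficients of the explicit series -/

theorem single_add_single_le_iff (k : ℕ) (v : Fin 2 →₀ ℕ) :
    Finsupp.single 0 k + Finsupp.single 1 k ≤ v ↔ k ≤ v 0 ∧ k ≤ v 1 := by
  rw [Finsupp.le_def, Fin.forall_fin_two]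
  simp

theorem X_mul_X_pow {R : Type*} [CommRing R] (k : ℕ) :
    ((MvPowerSeries.X 0 : MvPowerSeries (Fin 2) R) * MvPowerSeries.X 1) ^ k =
      MvPowerSeries.monomial (Finsupp.single 0 k + Finsupp.single 1 k) 1 := by
  rw [mul_pow, MvPowerSeries.X_pow_eq, MvPowerSeries.X_pow_eq, MvPowerSeries.monomial_mul_monomial,
    one_mul]

/-- The power series with coefficients `q ^ (v₀ + v₁)`. -/
def geometricSeries {R : Type*} [CommRing R] (q : R) : MvPowerSeries (Fin 2) R :=
  fun v => q ^ (v 0 + v 1)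

theorem coeff_geometricSeries {R : Type*} [CommRing R] (q : R) (v : Fin 2 →₀ ℕ) :
    MvPowerSeries.coeff v (geometricSeries q) = q ^ (v 0 + v 1) := rfl

theorem invOfUnit_geometric {R : Type*} [CommRing R] (q : R) :
    MvPowerSeries.invOfUnit ((1 - MvPowerSeries.C q * MvPowerSeries.X 0) *
      (1 - MvPowerSeries.C q * MvPowerSeries.X 1) : MvPowerSeries (Fin 2) R) 1 =
      geometricSeries q := by
  -- `E₀` is the expansion of `1 / (1 - q t₁)`, reached by cancelling the `t₂` factor first.
  set E₀ : MvPowerSeries (Fin 2) R := fun v => if v 1 = 0 then q ^ v 0 else 0 with hE₀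
  have hE₀c : ∀ v, MvPowerSeries.coeff v E₀ = if v 1 = 0 then q ^ v 0 else 0 := fun v => rfl
  have hCX : ∀ s : Fin 2, (MvPowerSeries.C q * MvPowerSeries.X s : MvPowerSeries (Fin 2) R) =
      MvPowerSeries.monomial (Finsupp.single s 1) q := by
    intro s
    rw [MvPowerSeries.X, ← MvPowerSeries.monomial_zero_eq_C_apply,
      MvPowerSeries.monomial_mul_monomial, zero_add, mul_one]
  have h1 : (1 - MvPowerSeries.C q * MvPowerSeries.X 1) * geometricSeries q = E₀ := by
    ext v
    rw [sub_mul, one_mul, hCX, map_sub, MvPowerSeries.coeff_monomial_mul, hE₀c]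
    simp only [coeff_geometricSeries, Finsupp.single_le_iff]
    by_cases h : v 1 = 0
    · simp [h]
    · have h2 : 1 ≤ v 1 := Nat.one_le_iff_ne_zero.2 h
      rw [if_pos h2, if_neg h]
      have h3 : (v - Finsupp.single 1 1 : Fin 2 →₀ ℕ) 0 + (v - Finsupp.single 1 1 : Fin 2 →₀ ℕ) 1 + 1 = v 0 + v 1 := by
        simp; omega
      rw [← h3]; ring
  have h2 : (1 - MvPowerSeries.C q * MvPowerSeries.X 0) * E₀ = 1 := by
    ext v
    rw [sub_mul, one_mul, hCX, map_sub, MvPowerSeries.coeff_monomial_mul, MvPowerSeries.coeff_one]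
    simp only [hE₀c, Finsupp.single_le_iff]
    have hv0 : v = 0 ↔ v 0 = 0 ∧ v 1 = 0 := by
      rw [Finsupp.ext_iff, Fin.forall_fin_two]; rfl
    by_cases h : v 1 = 0
    · by_cases h' : v 0 = 0
      · simp [hv0, h, h']
      · have h2 : 1 ≤ v 0 := Nat.one_le_iff_ne_zero.2 h'
        rw [if_pos h2, if_neg (show v ≠ 0 by rw [Ne, hv0]; tauto), if_pos h,
          if_pos (by simp [h])]
        have h3 : (v - Finsupp.single 0 1 : Fin 2 →₀ ℕ) 0 + 1 = v 0 := by simp; omega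
        rw [← h3]; ring
    · simp [hv0, h]
  have h3 : ((1 - MvPowerSeries.C q * MvPowerSeries.X 0) *
      (1 - MvPowerSeries.C q * MvPowerSeries.X 1) : MvPowerSeries (Fin 2) R) * geometricSeries q = 1 := by
    rw [mul_assoc, h1, h2]
  have h4 := MvPowerSeries.mul_invOfUnit ((1 - MvPowerSeries.C q * MvPowerSeries.X 0) *
      (1 - MvPowerSeries.C q * MvPowerSeries.X 1) : MvPowerSeries (Fin 2) R) 1 (by simp)
  rw [mul_comm] at h4
  exact left_inv_eq_right_inv h4 h3

theorem coeff_seriesA {R : Type*} [CommRing R] (q : R) (n : ℕ) (v : Fin 2 →₀ ℕ) :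
    MvPowerSeries.coeff v (seriesA q n) = coeffA q n (v 0) (v 1) := by
  simp only [seriesA, invOfUnit_geometric, X_mul_X_pow]
  have hC : ∀ (c : R) (m : Fin 2 →₀ ℕ), MvPowerSeries.C c * MvPowerSeries.monomial m (1 : R) =
      MvPowerSeries.monomial m c := by
    intro c m
    rw [← MvPowerSeries.monomial_zero_eq_C_apply, MvPowerSeries.monomial_mul_monomial, zero_add,
      mul_one]
  simp only [hC, map_add, map_sum, MvPowerSeries.coeff_monomial, MvPowerSeries.coeff_monomial_mul,
    single_add_single_le_iff, coeff_geometricSeries]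
  have hv : ∀ k, v = Finsupp.single 0 k + Finsupp.single 1 k ↔ v 0 = k ∧ v 1 = k := by
    intro k
    rw [Finsupp.ext_iff, Fin.forall_fin_two]
    simp
  simp only [hv]
  rw [coeffA]
  by_cases hge : n ≤ v 0 ∧ n ≤ v 1
  · rw [if_pos hge, if_pos hge, Finset.sum_eq_zero, zero_add]
    · have h3 : v 0 + v 1 - n = n + ((v - (Finsupp.single 0 n + Finsupp.single 1 n) : Fin 2 →₀ ℕ) 0 +
          (v - (Finsupp.single 0 n + Finsupp.single 1 n) : Fin 2 →₀ ℕ) 1) := by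
        simp; omega
      rw [h3, pow_add]; ring
    · intro k hk
      rw [Finset.mem_range] at hk
      exact if_neg (by omega)
  · rw [if_neg hge, if_neg hge, add_zero]
    split_ifs with heq
    · rw [Finset.sum_eq_single (v 0), if_pos ⟨rfl, heq.symm⟩]
      · intro k _ hk
        exact if_neg fun h => hk h.1.symm
      · intro h
        rw [Finset.mem_range] at h
        omega
    · refine Finset.sum_eq_zero fun k _ => if_neg ?_
      rintro ⟨h1, h2⟩
      exact heq (h1.trans h2.symm)

/-- The coefficients of the explicit series in terms of the codimensions. -/
theorem coeffA_mul_one_sub {R : Type*} [CommRing R] (q : R) (n a b : ℕ) :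
    coeffA q n a b * (1 - q) = q ^ codimA n (a + 1) (b + 1) - q ^ codimA n a (b + 1) -
      q ^ codimA n (a + 1) b + q ^ codimA n a b := by
  unfold coeffA
  split_ifs with hge heq
  · have h1 : codimA n a b = a + b - n := by unfold codimA; omega
    have h2 : codimA n (a + 1) b = a + b - n + 1 := by unfold codimA; omega
    have h3 : codimA n a (b + 1) = a + b - n + 1 := by unfold codimA; omega
    have h4 : codimA n (a + 1) (b + 1) = a + b - n + 2 := by unfold codimA; omega
    rw [h1, h2, h3, h4]; ring
  · have h1 : codimA n a b = a := by unfold codimA; omega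
    have h2 : codimA n (a + 1) b = a + 1 := by unfold codimA; omega
    have h3 : codimA n a (b + 1) = a + 1 := by unfold codimA; omega
    have h4 : codimA n (a + 1) (b + 1) = a + 1 := by unfold codimA; omega
    rw [h1, h2, h3, h4]; ring
  · rcases lt_or_gt_of_ne heq with h | h
    · have h1 : codimA n a b = codimA n (a + 1) b := by unfold codimA; omega
      have h2 : codimA n a (b + 1) = codimA n (a + 1) (b + 1) := by unfold codimA; omega
      rw [h1, h2]; ring
    · have h1 : codimA n a b = codimA n a (b + 1) := by unfold codimA; omega
      have h2 : codimA n (a + 1) b = codimA n (a + 1) (b + 1) := by unfold codimA; omega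
      rw [h1, h2]; ring

/-- If some `v i < 0`, raising it by one leaves `toNat` at `0`, so the right side cancels in pairs,
matching the coefficient zero. -/
theorem intCoeff_seriesA_mul {R : Type} [CommRing R] (q : R) (n : ℕ) (v : Fin 2 → ℤ) :
    intCoeff (seriesA q n) v * (1 - q) =
      q ^ codimA n (v 0 + 1).toNat (v 1 + 1).toNat - q ^ codimA n (v 0).toNat (v 1 + 1).toNat -
      q ^ codimA n (v 0 + 1).toNat (v 1).toNat + q ^ codimA n (v 0).toNat (v 1).toNat := by
  unfold intCoeff
  split_ifs with h
  · rw [Fin.forall_fin_two] at h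
    have h0 : (v 0 + 1).toNat = (v 0).toNat + 1 := by omega
    have h1 : (v 1 + 1).toNat = (v 1).toNat + 1 := by omega
    rw [coeff_seriesA, h0, h1, ← coeffA_mul_one_sub]
    rfl
  · rw [Fin.forall_fin_two, not_and_or] at h
    rcases h with h | h
    · have h0 : (v 0 + 1).toNat = (v 0).toNat := by omega
      rw [h0]; ring
    · have h1 : (v 1 + 1).toNat = (v 1).toNat := by omega
      rw [h1]; ring

theorem sum_finset_fin_two {M : Type*} [AddCommMonoid M] (f : Finset (Fin 2) → M) :
    ∑ I, f I = f ∅ + f {0} + f {1} + f {0, 1} := by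
  have h : (Finset.univ : Finset (Finset (Fin 2))) = {∅, {0}, {1}, {0, 1}} := by decide
  rw [h, Finset.sum_insert (by decide), Finset.sum_insert (by decide),
    Finset.sum_insert (by decide), Finset.sum_singleton]
  abel

end MotivicPoincare

theorem proposition5 (n : ℕ) (hn : 1 ≤ n) (γ : Fin 2 → MotivicPoincare.Arc)
    (hγ : MotivicPoincare.IsUniformization {p : ℂ × ℂ | p.2 ^ 2 = p.1 ^ (2 * n)} γ) :
    MotivicPoincare.IsMotivicPoincareSeries γ
        (MotivicPoincare.seriesA MotivicPoincare.qMot n) ∧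
      MotivicPoincare.IsFiltrationPoincareSeries γ
        (MotivicPoincare.seriesA (RatFunc.X : RatFunc ℚ) n) := by
  open MotivicPoincare in
  obtain ⟨ε, hε, h0, h1⟩ := exists_branchParam hn hγ
  refine ⟨fun v => ?_, fun v => finite_quotient_filtration h0 h1 v, fun v => ?_⟩
  · rw [coeff_seriesA]
    exact hasMeasure_levelSet hn hε h0 h1 v
  · have hq : (1 - RatFunc.X : RatFunc ℚ) ≠ 0 := by
      rw [sub_ne_zero, ← map_one (algebraMap (Polynomial ℚ) (RatFunc ℚ)), ← RatFunc.algebraMap_X]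
      exact fun h => Polynomial.X_ne_C 1 ((RatFunc.algebraMap_injective ℚ h).symm)
    rw [sum_finset_fin_two]
    simp only [coeffL, codim_eq hn hε h0 h1]
    -- Once `1 - q` is cleared, the first terms of the four `coeffL` assemble to the coefficient at
    -- `v - 1`, and the subtracted terms to the one at `v`.
    have e1 := intCoeff_seriesA_mul (RatFunc.X : RatFunc ℚ) n (v - 1)
    have e2 := intCoeff_seriesA_mul (RatFunc.X : RatFunc ℚ) n v
    simp only [Pi.sub_apply, Pi.one_apply, sub_add_cancel] at e1
    refine mul_right_cancel₀ hq ?_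
    rw [sub_mul, e1, e2]
    simp [Set.indicator]
    field_simp
    ring
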